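/- Let $n,m\in\mathbb N$, $T>0$, let $\mathbb S^n$ be the symmetric real $n\times n$ matrices with the order $M\le N$ iff $N-M$ is positive semi-definite, let $\mathbb S^n_+=\{M\in\mathbb S^n: M\ge 0\}$, and let $\Delta^*[0,T]=\{(t,s): 0\le t\le s\le T\}$. Assume: (H1) $A,C\in C([0,T];\mathbb R^{n\times n})$, $B,D\in C([0,T];\mathbb R^{n\times m})$, $G\in C([0,T];\mathbb S^n)$, $Q\in C([0,T]^2;\mathbb S^n)$, $R\in C([0,T]^2;\mathbb S^m)$. (H2) There is a constant $\delta>0$ such that $Q(t,s)\ge 0$, $R(t,s)\ge\delta I$ and $G(t)\ge 0$ for all $0\le t\le s\le T$. (H3) There are positive definite matrices $\widehat Q,\widehat R,\widehat G$ such that $Q(t,s)\le Q(r,s)\le\widehat Q$, $R(t,s)\le R(r,s)\le\widehat R$ and $G(t)\le G(r)\le\widehat G$ for all $0\le t\le r\le s\le T$. (H4) $G$ is $C^1$ on $[0,T]$ and, for each $s\in[0,T]$, the maps $t\mapsto Q(t,s)$ and $t\mapsto R(t,s)$ are $C^1$ on $[0,s]$. Then there is a unique continuous $P:\Delta^*[0,T]\to\mathbb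 S^n_+$ that solves the equilibrium Riccati equation $$\begin{cases}\partial_sP(t,s)+P(t,s)A_\Theta(s)+A_\Theta(s)^\top P(t,s)+C_\Theta(s)^\top P(t,s)C_\Theta(s)+Q(t,s)+\Theta(s)^\top R(t,s)\Theta(s)=0,& 0\le t\le s\le T,\\ P(t,T)=G(t),& 0\le t\le T,\end{cases}$$ where $\partial_s$ is one-sided at the end points of $[t,T]$ and $$\Theta(s)=-[R(s,s)+D(s)^\top P(s,s)D(s)]^{-1}[B(s)^\top P(s,s)+D(s)^\top P(s,s)C(s)],$$ $$A_\Theta(s)=A(s)+B(s)\Theta(s),\qquad C_\Theta(s)=C(s)+D(s)\Theta(s),\qquad s\in[0,T].$$ Moreover, the function $\Theta$ belongs to $C([0,T];\mathbb R^{m\times n})$. -/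

import Mathlib

/-- The data of a time-inconsistent stochastic linear-quadratic problem with `n`-dimensional state
and `m`-dimensional control: coefficients `A, B, C, D` and weights `Q, R, G`. Only the values at
times in `[0, T]` are ever used. -/
structure SLQData (n m : ℕ) where
  A : ℝ → Matrix (Fin n) (Fin n) ℝ
  B : ℝ → Matrix (Fin n) (Fin m) ℝ
  C : ℝ → Matrix (Fin n) (Fin n) ℝ
  D : ℝ → Matrix (Fin n) (Fin m) ℝ
  Q : ℝ → ℝ → Matrix (Fin n) (Fin n) ℝ
  R : ℝ → ℝ → Matrix (Fin m) (Fin m) ℝ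
  G : ℝ → Matrix (Fin n) (Fin n) ℝ

/-- The triangle `Δ*[0,T] = {(t, s) : 0 ≤ t ≤ s ≤ T}`. -/
def triangle (T : ℝ) : Set (ℝ × ℝ) := {p | 0 ≤ p.1 ∧ p.1 ≤ p.2 ∧ p.2 ≤ T}

namespace SLQData

variable {n m : ℕ}

/-- (H1): continuity of all data; the weights take symmetric values. -/
structure H1 (c : SLQData n m) (T : ℝ) : Prop where
  contA : ContinuousOn c.A (Set.Icc 0 T)
  contB : ContinuousOn c.B (Set.Icc 0 T)
  contC : ContinuousOn c.C (Set.Icc 0 T)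
  contD : ContinuousOn c.D (Set.Icc 0 T)
  contQ : ContinuousOn (Function.uncurry c.Q) (Set.Icc 0 T ×ˢ Set.Icc 0 T)
  contR : ContinuousOn (Function.uncurry c.R) (Set.Icc 0 T ×ˢ Set.Icc 0 T)
  contG : ContinuousOn c.G (Set.Icc 0 T)
  symmQ : ∀ t ∈ Set.Icc 0 T, ∀ s ∈ Set.Icc 0 T, (c.Q t s).IsSymm
  symmR : ∀ t ∈ Set.Icc 0 T, ∀ s ∈ Set.Icc 0 T, (c.R t s).IsSymm
  symmG : ∀ t ∈ Set.Icc 0 T, (c.G t).IsSymm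

/-- (H2): `Q ≥ 0`, `R ≥ δ I` and `G ≥ 0` for some constant `δ > 0`. -/
def H2 (c : SLQData n m) (T : ℝ) : Prop :=
  ∃ δ : ℝ, 0 < δ ∧ ∀ t s : ℝ, 0 ≤ t → t ≤ s → s ≤ T →
    (c.Q t s).PosSemidef ∧
    (c.R t s - δ • (1 : Matrix (Fin m) (Fin m) ℝ)).PosSemidef ∧
    (c.G t).PosSemidef

/-- (H3): the weights are nondecreasing in `t` and bounded above by positive definite matrices. -/
def H3 (c : SLQData n m) (T : ℝ) : Prop :=
  ∃ (Qhat : Matrix (Fin n) (Fin n) ℝ) (Rhat : Matrix (Fin m) (Fin m) ℝ)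
    (Ghat : Matrix (Fin n) (Fin n) ℝ),
    Qhat.PosDef ∧ Rhat.PosDef ∧ Ghat.PosDef ∧
    ∀ t r s : ℝ, 0 ≤ t → t ≤ r → r ≤ s → s ≤ T →
      (c.Q r s - c.Q t s).PosSemidef ∧ (Qhat - c.Q r s).PosSemidef ∧
      (c.R r s - c.R t s).PosSemidef ∧ (Rhat - c.R r s).PosSemidef ∧
      (c.G r - c.G t).PosSemidef ∧ (Ghat - c.G r).PosSemidef

/-- (H4): the weights are (entrywise) continuously differentiable in `t`, namely `G` on `[0, T]`
and `Q(·, s)`, `R(·, s)` on `[0, s]` for every `s ∈ [0, T]`. -/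
structure H4 (c : SLQData n m) (T : ℝ) : Prop where
  smoothG : ∀ i j, ContDiffOn ℝ 1 (fun t => c.G t i j) (Set.Icc 0 T)
  smoothQ : ∀ s ∈ Set.Icc 0 T, ∀ i j, ContDiffOn ℝ 1 (fun t => c.Q t s i j) (Set.Icc 0 s)
  smoothR : ∀ s ∈ Set.Icc 0 T, ∀ i j, ContDiffOn ℝ 1 (fun t => c.R t s i j) (Set.Icc 0 s)

/-- The feedback
`Θ(s) = -[R(s,s) + D(s)ᵀ P(s,s) D(s)]⁻¹ [B(s)ᵀ P(s,s) + D(s)ᵀ P(s,s) C(s)]`. -/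
noncomputable def Theta (c : SLQData n m) (P : ℝ → ℝ → Matrix (Fin n) (Fin n) ℝ) (s : ℝ) :
    Matrix (Fin m) (Fin n) ℝ :=
  -((c.R s s + (c.D s).transpose * P s s * c.D s)⁻¹ *
    ((c.B s).transpose * P s s + (c.D s).transpose * P s s * c.C s))

/-- `A_Θ(s) = A(s) + B(s) Θ(s)`. -/
noncomputable def ATheta (c : SLQData n m) (P : ℝ → ℝ → Matrix (Fin n) (Fin n) ℝ) (s : ℝ) :
    Matrix (Fin n) (Fin n) ℝ :=
  c.A s + c.B s * c.Theta P s

/-- `C_Θ(s) = C(s) + D(s) Θ(s)`. -/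
noncomputable def CTheta (c : SLQData n m) (P : ℝ → ℝ → Matrix (Fin n) (Fin n) ℝ) (s : ℝ) :
    Matrix (Fin n) (Fin n) ℝ :=
  c.C s + c.D s * c.Theta P s

/-- `P ∈ C(Δ*[0,T]; 𝕊ⁿ₊)` solves the equilibrium Riccati equation on `Δ*[0,T]`. The derivative
in `s` is one-sided at the ends of `[t, T]`. Only the values of `P` on the triangle matter. -/
structure IsERESolution (c : SLQData n m) (T : ℝ)
    (P : ℝ → ℝ → Matrix (Fin n) (Fin n) ℝ) : Prop where
  cont : ContinuousOn (Function.uncurry P) (triangle T)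
  posSemidef : ∀ t s : ℝ, (t, s) ∈ triangle T → (P t s).PosSemidef
  equation : ∀ t s : ℝ, (t, s) ∈ triangle T →
    HasDerivWithinAt (fun u => P t u)
      (-(P t s * c.ATheta P s + (c.ATheta P s).transpose * P t s
        + (c.CTheta P s).transpose * P t s * c.CTheta P s
        + c.Q t s + (c.Theta P s).transpose * c.R t s * c.Theta P s))
      (Set.Icc t T) s
  terminal : ∀ t ∈ Set.Icc 0 T, P t T = c.G t

end SLQData

/-!
# Well-posedness of the equilibrium Riccati equation

**Idea.** For a given feedback `Θ` the equation for `P(t, ·)` is a linear backward Lyapunov equation;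
all values of `t` are coupled only through the diagonal `P(s, s)`, which determines `Θ(s)`. Thus the
equation is an ordinary differential equation in the Banach space `C([0,T]; ℝⁿˣⁿ)` for
`s ↦ P(·, s)`, in which the diagonal value is an evaluation (`vectorField`). For this the data are
extended to all of `[0,T]²` in such a way that positivity and monotonicity in `t` persist (`extend`),
and matrix inversion, needed only on `{S : S ≥ δ I}`, is replaced by a globally Lipschitz map `J`
that agrees with it there (`exists_lipschitz_inv`). Since the right-hand side grows superlinearly,
every occurrence of `P` in it is first scaled by a factor `w(s) ∈ [0, 1]` that keeps it in a fixed
ball. The truncated equation has a solution on the whole of `[0,T]` by Picard–Lindelöf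
(`exists_isTruncatedSolution`).

**A priori bound.** It has to be independent of the truncation. Solutions of Lyapunov equations
with nonnegative data are nonnegative (`posSemidef_of_lyapunov_of_bounded`), so `P(t, s) ≥ 0`, and,
by the monotonicity of the weights, `P(t, s) ≤ P(r, s)` for `t ≤ r`
(`IsTruncatedSolution.sub_posSemidef`). Hence `r ↦ P(s, r)` lies below the diagonal `r ↦ P(r, r)` for
`r ≥ s` and touches it at `s`. Its derivative there is controlled from below by the equation with
zero control, because `Θ(s)` minimizes the convex quadratic function of the control that appears on
the diagonal (`trace_field_diag_le`); scaling by `w(s)` does not harm this. A one-sided Grönwall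
argument (`le_exp_of_minorant_deriv`) bounds the trace of the diagonal, hence `Θ`, hence `P`
(`exists_norm_bound`). If the truncation radius exceeds this bound, the factor `w` is identically `1`
and the equation itself is solved.

**Uniqueness.** The difference `f` of two solutions satisfies
`‖∂ₛ f(t, s)‖ ≤ K (‖f(t, s)‖ + ‖f(s, s)‖)` with `f(t, T) = 0`, which forces `f = 0` by a weighted
sup-norm argument on the triangle (`eq_zero_of_norm_deriv_le`). Continuity of `Θ` follows from its
expression through the diagonal of `P` and the continuity of inversion.
-/

namespace EquilibriumRiccati

open Matrix Set Filter Topology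

attribute [local instance] Matrix.normedAddCommGroup Matrix.normedSpace

variable {l n m : ℕ}

/-! ### Matrix estimates in the entrywise sup norm -/

theorem norm_mul_le_card (M : Matrix (Fin l) (Fin n) ℝ) (N : Matrix (Fin n) (Fin m) ℝ) :
    ‖M * N‖ ≤ n * (‖M‖ * ‖N‖) := by
  rw [Matrix.norm_le_iff (by positivity)]
  intro i j
  rw [Matrix.mul_apply]
  refine (norm_sum_le _ _).trans ?_
  calc ∑ k, ‖M i k * N k j‖ ≤ ∑ _k : Fin n, ‖M‖ * ‖N‖ := by
        refine Finset.sum_le_sum fun k _ => ?_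
        rw [norm_mul]
        exact mul_le_mul (M.norm_entry_le_entrywise_sup_norm) (N.norm_entry_le_entrywise_sup_norm)
          (norm_nonneg _) (norm_nonneg _)
    _ = n * (‖M‖ * ‖N‖) := by simp

theorem abs_trace_le (M : Matrix (Fin n) (Fin n) ℝ) : |M.trace| ≤ n * ‖M‖ := by
  refine (Finset.abs_sum_le_sum_abs _ _).trans ?_
  calc ∑ i, |M i i| ≤ ∑ _i : Fin n, ‖M‖ :=
        Finset.sum_le_sum fun i _ => M.norm_entry_le_entrywise_sup_norm
    _ = n * ‖M‖ := by simp

/-- The quadratic form `xᵀ M x`, as a continuous linear functional of `M`. -/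
noncomputable def quadForm (x : Fin n → ℝ) : Matrix (Fin n) (Fin n) ℝ →L[ℝ] ℝ :=
  LinearMap.toContinuousLinearMap
    { toFun := fun M => x ⬝ᵥ (M *ᵥ x)
      map_add' := fun M N => by rw [add_mulVec, dotProduct_add]
      map_smul' := fun r M => by rw [smul_mulVec, dotProduct_smul]; rfl }

theorem quadForm_apply (x : Fin n → ℝ) (M : Matrix (Fin n) (Fin n) ℝ) :
    quadForm x M = x ⬝ᵥ (M *ᵥ x) := rfl

theorem posSemidef_iff_quadForm {M : Matrix (Fin n) (Fin n) ℝ} :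
    M.PosSemidef ↔ Mᵀ = M ∧ ∀ x, 0 ≤ quadForm x M := by
  rw [posSemidef_iff_dotProduct_mulVec]
  simp [IsHermitian, quadForm_apply]

/-- It suffices to test positivity of a quadratic form on unit vectors. -/
theorem quadForm_nonneg_of_unit {M : Matrix (Fin n) (Fin n) ℝ}
    (h : ∀ x : Fin n → ℝ, x ⬝ᵥ x = 1 → 0 ≤ quadForm x M) (x : Fin n → ℝ) : 0 ≤ quadForm x M := by
  by_cases hx : x ⬝ᵥ x = 0
  · rw [dotProduct_self_eq_zero] at hx
    simp [quadForm_apply, hx]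
  have hpos : 0 < x ⬝ᵥ x := lt_of_le_of_ne (dotProduct_self_star_nonneg x) (Ne.symm hx)
  have hs : Real.sqrt (x ⬝ᵥ x) * Real.sqrt (x ⬝ᵥ x) = x ⬝ᵥ x := Real.mul_self_sqrt hpos.le
  have hr : 0 < Real.sqrt (x ⬝ᵥ x) := Real.sqrt_pos.2 hpos
  have key := h ((Real.sqrt (x ⬝ᵥ x))⁻¹ • x) (by
    rw [smul_dotProduct, dotProduct_smul, smul_eq_mul, smul_eq_mul]
    field_simp
    rw [sq]; exact hs.symm)
  rw [quadForm_apply, mulVec_smul, smul_dotProduct, dotProduct_smul, smul_eq_mul,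
    smul_eq_mul] at key
  rw [quadForm_apply]
  have h2 : 0 < (Real.sqrt (x ⬝ᵥ x))⁻¹ := inv_pos.2 hr
  exact (mul_nonneg_iff_of_pos_left h2).1 ((mul_nonneg_iff_of_pos_left h2).1 key)

theorem abs_le_one_of_unit {x : Fin n → ℝ} (hx : x ⬝ᵥ x = 1) (i : Fin n) : |x i| ≤ 1 := by
  rw [← sq_le_one_iff_abs_le_one, ← hx, sq]
  exact Finset.single_le_sum (f := fun j => x j * x j) (fun j _ => mul_self_nonneg _)
    (Finset.mem_univ i)

theorem abs_quadForm_le {x : Fin n → ℝ} (hx : x ⬝ᵥ x = 1) (M : Matrix (Fin n) (Fin n) ℝ) :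
    |quadForm x M| ≤ n * (n * ‖M‖) := by
  rw [quadForm_apply]
  calc |x ⬝ᵥ (M *ᵥ x)| ≤ ∑ i, |x i * ∑ j, M i j * x j| := Finset.abs_sum_le_sum_abs _ _
    _ ≤ ∑ _i : Fin n, (n * ‖M‖) := by
        refine Finset.sum_le_sum fun i _ => ?_
        rw [abs_mul]
        refine (mul_le_of_le_one_left (abs_nonneg _) (abs_le_one_of_unit hx i)).trans ?_
        refine (Finset.abs_sum_le_sum_abs _ _).trans ?_
        calc ∑ j, |M i j * x j| ≤ ∑ _j : Fin n, ‖M‖ := by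
              refine Finset.sum_le_sum fun j _ => ?_
              rw [abs_mul]
              exact (mul_le_of_le_one_right (abs_nonneg _) (abs_le_one_of_unit hx j)).trans
                M.norm_entry_le_entrywise_sup_norm
          _ = n * ‖M‖ := by simp
    _ = n * (n * ‖M‖) := by simp

/-- The trace dominates the sup norm on the positive semidefinite cone. -/
theorem norm_le_trace {M : Matrix (Fin n) (Fin n) ℝ} (hM : M.PosSemidef) : ‖M‖ ≤ M.trace := by
  have hdiag : ∀ i, 0 ≤ M i i := fun i => hM.diag_nonneg
  have hle : ∀ i, M i i ≤ M.trace := fun i =>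
    Finset.single_le_sum (f := fun j => M j j) (fun j _ => hdiag j) (Finset.mem_univ i)
  rw [Matrix.norm_le_iff hM.trace_nonneg]
  intro i j
  have hsymm : M j i = M i j := by
    have := congrFun (congrFun (posSemidef_iff_quadForm.1 hM).1 i) j
    simpa using this
  have hp := (posSemidef_iff_quadForm.1 hM).2 (Pi.single i 1 + Pi.single j 1)
  have hn := (posSemidef_iff_quadForm.1 hM).2 (Pi.single i 1 - Pi.single j 1)
  simp [quadForm_apply, mulVec_add, mulVec_sub, hsymm] at hp hn
  rw [Real.norm_eq_abs, abs_le]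
  constructor <;> linarith [hle i, hle j]

theorem posSemidef_congr {M : Matrix (Fin n) (Fin n) ℝ} (hM : M.PosSemidef)
    (N : Matrix (Fin n) (Fin m) ℝ) : (Nᵀ * M * N).PosSemidef := by
  simpa using hM.conjTranspose_mul_mul_same N

theorem isCompact_unitVectors : IsCompact {x : Fin n → ℝ | x ⬝ᵥ x = 1} := by
  refine Metric.isCompact_of_isClosed_isBounded ?_ ?_
  · exact isClosed_eq (by fun_prop) continuous_const
  · refine (Metric.isBounded_closedBall (x := (0 : Fin n → ℝ)) (r := 1)).subset fun x hx => ?_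
    rw [mem_closedBall_zero_iff, pi_norm_le_iff_of_nonneg zero_le_one]
    exact fun i => abs_le_one_of_unit hx i

/-! ### Positivity for Lyapunov equations -/

/-- Strict form of the positivity below: the perturbation `ε e^{L(T-s)} I` is a strict
supersolution, so at the last time where positivity fails the derivative of the vanishing quadratic
form has the wrong sign. -/
theorem lyapunov_perturbed_pos {T K ε : ℝ} (hε : 0 < ε)
    {Y a c q : ℝ → Matrix (Fin n) (Fin n) ℝ} {w : ℝ → ℝ}
    (hw : ∀ s ∈ Icc 0 T, 0 ≤ w s)
    (hK : ∀ s ∈ Icc 0 T, ‖a s + (a s)ᵀ + w s • ((c s)ᵀ * c s)‖ ≤ K)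
    (hq : ∀ s ∈ Icc 0 T, (q s).PosSemidef)
    (hsymm : ∀ s ∈ Icc 0 T, (Y s)ᵀ = Y s)
    (hY : ∀ s ∈ Icc 0 T, HasDerivWithinAt Y
      (-(Y s * a s + (a s)ᵀ * Y s + w s • ((c s)ᵀ * Y s * c s) + q s)) (Icc 0 T) s)
    (hT : (Y T).PosSemidef) :
    ∀ s ∈ Icc 0 T, ∀ x : Fin n → ℝ, x ⬝ᵥ x = 1 →
      0 < quadForm x (Y s) + ε * Real.exp ((n * (n * K) + 1) * (T - s)) := by
  -- `n * (n * K)` bounds the form `a + aᵀ + w cᵀc` on unit vectors, the defect that the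
  -- perturbation has to absorb.
  set L : ℝ := n * (n * K) + 1 with hL
  by_contra! hbad
  obtain ⟨s₁, hs₁, x₁, hx₁, hneg₁⟩ := hbad
  have hYc : ContinuousOn Y (Icc 0 T) := fun s hs => (hY s hs).continuousWithinAt
  set φ : ℝ × (Fin n → ℝ) → ℝ := fun p =>
    quadForm p.2 (Y p.1) + ε * Real.exp (L * (T - p.1)) with hφ
  have hφc : ContinuousOn φ (Icc 0 T ×ˢ {x | x ⬝ᵥ x = 1}) := by
    have h1 : ContinuousOn (fun p : ℝ × (Fin n → ℝ) => Y p.1) (Icc 0 T ×ˢ {x | x ⬝ᵥ x = 1}) :=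
      hYc.comp continuousOn_fst fun p hp => hp.1
    have h2 : Continuous
        (fun z : Matrix (Fin n) (Fin n) ℝ × (Fin n → ℝ) => z.2 ⬝ᵥ (z.1 *ᵥ z.2)) := by
      fun_prop
    refine (h2.comp_continuousOn (h1.prodMk continuousOn_snd)).add ?_
    exact Continuous.continuousOn (by fun_prop)
  have hcomp : IsCompact ((Icc 0 T ×ˢ {x : Fin n → ℝ | x ⬝ᵥ x = 1}) ∩ φ ⁻¹' Iic 0) := by
    have hc := (isCompact_Icc (a := (0 : ℝ)) (b := T)).prod (isCompact_unitVectors (n := n))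
    exact hc.of_isClosed_subset (hφc.preimage_isClosed_of_isClosed hc.isClosed isClosed_Iic)
      inter_subset_left
  -- The last time at which positivity fails, together with a vector witnessing the failure.
  obtain ⟨⟨s₀, x₀⟩, ⟨⟨hs₀, hx₀⟩, hneg⟩, hmax⟩ :=
    hcomp.exists_isMaxOn ⟨(s₁, x₁), ⟨hs₁, hx₁⟩, hneg₁⟩ continuous_fst.continuousOn
  simp only [mem_ofPred_eq] at hx₀
  replace hs₀ : s₀ ∈ Icc 0 T := hs₀
  replace hneg : quadForm x₀ (Y s₀) + ε * Real.exp (L * (T - s₀)) ≤ 0 := hneg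
  have hafter : ∀ s ∈ Ioc s₀ T, ∀ x : Fin n → ℝ, x ⬝ᵥ x = 1 → 0 < φ (s, x) := by
    intro s hs x hx
    by_contra! h
    have := hmax (show (s, x) ∈ _ from ⟨⟨⟨hs₀.1.trans hs.1.le, hs.2⟩, hx⟩, h⟩)
    exact absurd hs.1 (not_lt.2 this)
  have hs₀T : s₀ < T := by
    rcases hs₀.2.lt_or_eq with h | h
    · exact h
    · exfalso
      have h1 := (posSemidef_iff_quadForm.1 hT).2 x₀
      rw [h] at hneg
      simp at hneg
      linarith
  have hφder : ∀ x, HasDerivWithinAt (fun s => φ (s, x))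
      (quadForm x (-(Y s₀ * a s₀ + (a s₀)ᵀ * Y s₀ + w s₀ • ((c s₀)ᵀ * Y s₀ * c s₀) + q s₀))
        + ε * (Real.exp (L * (T - s₀)) * (-L))) (Ioi s₀) s₀ := by
    intro x
    have h1 : HasDerivWithinAt Y _ (Ioi s₀) s₀ := (hY s₀ hs₀).mono_of_mem_nhdsWithin
      (mem_of_superset (Ioc_mem_nhdsGT hs₀T) fun s hs => ⟨hs₀.1.trans hs.1.le, hs.2⟩)
    refine ((quadForm x).hasFDerivAt.comp_hasDerivWithinAt s₀ h1).add ?_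
    have h2 : HasDerivAt (fun s : ℝ => L * (T - s)) (-L) s₀ := by
      simpa using ((hasDerivAt_id s₀).const_sub T).const_mul L
    exact (h2.exp.const_mul ε).hasDerivWithinAt
  have hev : ∀ᶠ s in 𝓝[>] s₀, s ∈ Ioc s₀ T := Ioc_mem_nhdsGT hs₀T
  have hnonneg : ∀ x : Fin n → ℝ, x ⬝ᵥ x = 1 → 0 ≤ φ (s₀, x) := fun x hx =>
    ge_of_tendsto (hφder x).continuousWithinAt (hev.mono fun s hs => (hafter s hs x hx).le)
  set η : ℝ := ε * Real.exp (L * (T - s₀)) with hη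
  have hηpos : 0 < η := by positivity
  have hone : ∀ x : Fin n → ℝ, quadForm x (1 : Matrix (Fin n) (Fin n) ℝ) = x ⬝ᵥ x := fun x => by
    simp [quadForm_apply]
  set Z : Matrix (Fin n) (Fin n) ℝ := Y s₀ + η • 1 with hZ
  have hZpsd : Z.PosSemidef := by
    rw [posSemidef_iff_quadForm]
    refine ⟨by rw [hZ, transpose_add, hsymm s₀ hs₀, transpose_smul, transpose_one], ?_⟩
    refine quadForm_nonneg_of_unit fun x hx => ?_
    have := hnonneg x hx
    rw [hZ, map_add, map_smul, hone, hx]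
    simpa [hφ] using this
  have hzero : Z *ᵥ x₀ = 0 := by
    rw [← hZpsd.dotProduct_mulVec_zero_iff]
    have h1 := hnonneg x₀ hx₀
    have h2 : quadForm x₀ Z = quadForm x₀ (Y s₀) + η := by
      rw [hZ, map_add, map_smul, hone, hx₀]; simp
    simp only [star_trivial]
    rw [← quadForm_apply, h2]
    exact le_antisymm hneg h1
  -- The derivative at `s₀` is nonnegative since the form vanishes at `s₀` and is positive after.
  have hder_nonneg := ge_of_tendsto (b := (0 : ℝ))
    ((hasDerivWithinAt_iff_tendsto_slope' (by simp)).1 (hφder x₀)) (hev.mono fun s hs => by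
      rw [slope_def_field]
      have h1 := (hafter s hs x₀ hx₀).le
      have h2 : φ (s₀, x₀) ≤ 0 := hneg
      exact div_nonneg (by linarith) (sub_pos.2 hs.1).le)
  have hYZ : Y s₀ = Z - η • 1 := by rw [hZ]; abel
  have hexp : -(Y s₀ * a s₀ + (a s₀)ᵀ * Y s₀ + w s₀ • ((c s₀)ᵀ * Y s₀ * c s₀) + q s₀) =
      η • (a s₀ + (a s₀)ᵀ + w s₀ • ((c s₀)ᵀ * c s₀))
      - (Z * a s₀ + (a s₀)ᵀ * Z + w s₀ • ((c s₀)ᵀ * Z * c s₀) + q s₀) := by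
    rw [hYZ]
    simp only [sub_mul, mul_sub, smul_mul_assoc, mul_smul_comm, one_mul, mul_one, smul_add,
      smul_sub]
    rw [smul_comm η (w s₀)]
    abel
  rw [hexp] at hder_nonneg
  have hq0 := (posSemidef_iff_quadForm.1 (hq s₀ hs₀)).2 x₀
  have hc0 := (posSemidef_iff_quadForm.1 (posSemidef_congr hZpsd (c s₀))).2 x₀
  have ha1 : quadForm x₀ ((a s₀)ᵀ * Z) = 0 := by
    rw [quadForm_apply, ← mulVec_mulVec, hzero]; simp
  have ha2 : quadForm x₀ (Z * a s₀) = 0 := by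
    have hZt : Zᵀ = Z := (posSemidef_iff_quadForm.1 hZpsd).1
    rw [quadForm_apply, ← mulVec_mulVec, dotProduct_mulVec, ← mulVec_transpose, hZt, hzero]
    simp
  have hKb := (abs_le.1 (abs_quadForm_le hx₀ (a s₀ + (a s₀)ᵀ + w s₀ • ((c s₀)ᵀ * c s₀)))).2
  have hK' : (n : ℝ) * (n * ‖a s₀ + (a s₀)ᵀ + w s₀ • ((c s₀)ᵀ * c s₀)‖) ≤ n * (n * K) := by
    have := hK s₀ hs₀
    gcongr
  generalize a s₀ + (a s₀)ᵀ + w s₀ • ((c s₀)ᵀ * c s₀) = N at hder_nonneg hKb hK'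
  simp only [map_sub, map_smul, map_add, ha1, ha2, smul_eq_mul] at hder_nonneg
  have hwc := mul_nonneg (hw s₀ hs₀) hc0
  have : η * quadForm x₀ N ≤ η * (L - 1) :=
    mul_le_mul_of_nonneg_left (by rw [hL]; linarith) hηpos.le
  have hfin : ε * (Real.exp (L * (T - s₀)) * -L) = -(η * L) := by rw [hη]; ring
  rw [hfin] at hder_nonneg
  nlinarith

/-- A symmetric solution of the backward Lyapunov equation with positive semidefinite source and
terminal value is positive semidefinite. -/
theorem posSemidef_of_lyapunov {T K : ℝ}
    {Y a c q : ℝ → Matrix (Fin n) (Fin n) ℝ} {w : ℝ → ℝ}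
    (hw : ∀ s ∈ Icc 0 T, 0 ≤ w s)
    (hK : ∀ s ∈ Icc 0 T, ‖a s + (a s)ᵀ + w s • ((c s)ᵀ * c s)‖ ≤ K)
    (hq : ∀ s ∈ Icc 0 T, (q s).PosSemidef)
    (hsymm : ∀ s ∈ Icc 0 T, (Y s)ᵀ = Y s)
    (hY : ∀ s ∈ Icc 0 T, HasDerivWithinAt Y
      (-(Y s * a s + (a s)ᵀ * Y s + w s • ((c s)ᵀ * Y s * c s) + q s)) (Icc 0 T) s)
    (hT : (Y T).PosSemidef) : ∀ s ∈ Icc 0 T, (Y s).PosSemidef := by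
  intro s hs
  refine posSemidef_iff_quadForm.2 ⟨hsymm s hs, quadForm_nonneg_of_unit fun x hx => ?_⟩
  refine le_of_forall_pos_lt_add fun ε hε => ?_
  have he := Real.exp_pos ((n * (n * K) + 1) * (T - s))
  have := lyapunov_perturbed_pos (div_pos hε he) hw hK hq hsymm hY hT s hs x hx
  rwa [div_mul_cancel₀ _ he.ne'] at this

/-! ### Comparison lemmas in time -/

theorem isCompact_triangle (T : ℝ) : IsCompact (triangle T) := by
  have hsub : triangle T ⊆ Icc 0 T ×ˢ Icc 0 T := fun p hp =>
    ⟨⟨hp.1, hp.2.1.trans hp.2.2⟩, ⟨hp.1.trans hp.2.1, hp.2.2⟩⟩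
  refine (isCompact_Icc.prod isCompact_Icc).of_isClosed_subset ?_ hsub
  have : triangle T = {p : ℝ × ℝ | 0 ≤ p.1} ∩ ({p | p.1 ≤ p.2} ∩ {p | p.2 ≤ T}) := rfl
  rw [this]
  exact (isClosed_le continuous_const continuous_fst).inter
    ((isClosed_le continuous_fst continuous_snd).inter
      (isClosed_le continuous_snd continuous_const))

/-- Uniqueness for linear equations on the triangle that are coupled through the diagonal: the
weighted sup norm with weight `e^{-L(T-s)}`, `L > 4K`, is contracted by the integral equation. -/
theorem eq_zero_of_norm_deriv_le {E : Type*} [NormedAddCommGroup E] [NormedSpace ℝ E] {T K : ℝ}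
    (hK : 0 ≤ K) {f f' : ℝ → ℝ → E}
    (hc : ContinuousOn (Function.uncurry f) (triangle T))
    (hd : ∀ t s, (t, s) ∈ triangle T → HasDerivWithinAt (f t) (f' t s) (Icc t T) s)
    (hb : ∀ t s, (t, s) ∈ triangle T → ‖f' t s‖ ≤ K * (‖f t s‖ + ‖f s s‖))
    (hT : ∀ t ∈ Icc 0 T, f t T = 0) :
    ∀ t s, (t, s) ∈ triangle T → f t s = 0 := by
  intro t s hts
  set L : ℝ := 4 * K + 1 with hL
  have hLpos : 0 < L := by positivity
  have hgc : ContinuousOn (fun p : ℝ × ℝ => Real.exp (-(L * (T - p.2))) * ‖f p.1 p.2‖)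
      (triangle T) :=
    (Continuous.continuousOn (by fun_prop)).mul (continuous_norm.comp_continuousOn hc)
  obtain ⟨⟨t₀, s₀⟩, h₀, hmax⟩ := (isCompact_triangle T).exists_isMaxOn ⟨_, hts⟩ hgc
  set M : ℝ := Real.exp (-(L * (T - s₀))) * ‖f t₀ s₀‖ with hM
  have hle : ∀ t s, (t, s) ∈ triangle T → ‖f t s‖ ≤ M * Real.exp (L * (T - s)) := by
    intro t s h
    have h1 : Real.exp (-(L * (T - s))) * ‖f t s‖ ≤ M := hmax h
    calc ‖f t s‖ = Real.exp (-(L * (T - s))) * ‖f t s‖ * Real.exp (L * (T - s)) := by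
          rw [mul_right_comm, ← Real.exp_add]; simp
      _ ≤ M * Real.exp (L * (T - s)) := by gcongr
  have hM0 : 0 ≤ M := by positivity
  have hin : ∀ x ∈ Icc s₀ T, (t₀, x) ∈ triangle T := fun x hx =>
    ⟨h₀.1, h₀.2.1.trans hx.1, hx.2⟩
  have hder : ∀ x ∈ Icc s₀ T, HasDerivWithinAt (f t₀) (f' t₀ x) (Icc s₀ T) x := fun x hx =>
    (hd t₀ x (hin x hx)).mono (Icc_subset_Icc_left h₀.2.1)
  have hBd : ∀ x, HasDerivAt (fun x => 2 * K * M / L *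
      (Real.exp (L * (T - s₀)) - Real.exp (L * (T - x)))) (2 * K * M * Real.exp (L * (T - x))) x := by
    intro x
    have h1 : HasDerivAt (fun x : ℝ => L * (T - x)) (-L) x := by
      simpa using ((hasDerivAt_id x).const_sub T).const_mul L
    refine ((h1.exp.const_sub (Real.exp (L * (T - s₀)))).const_mul (2 * K * M / L)).congr_deriv ?_
    rw [mul_neg, mul_neg, mul_neg, neg_neg, mul_left_comm, div_mul_cancel₀ _ hLpos.ne', mul_comm]
  have key := image_norm_le_of_norm_deriv_right_le_deriv_boundary (a := s₀) (b := T)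
    (f := fun x => f t₀ x - f t₀ s₀) (f' := f' t₀)
    (fun x hx => ((hder x hx).continuousWithinAt).sub continuousWithinAt_const)
    (fun x hx => ((hder x (Ico_subset_Icc_self hx)).sub_const _).mono_of_mem_nhdsWithin
      (mem_of_superset (Icc_mem_nhdsGE hx.2) (Icc_subset_Icc_left hx.1)))
    (by simp) hBd
    (fun x hx => by
      have hx' := hin x (Ico_subset_Icc_self hx)
      have h1 := hle t₀ x hx'
      have h2 := hle x x ⟨hx'.1.trans hx'.2.1, le_rfl, hx'.2.2⟩
      calc ‖f' t₀ x‖ ≤ K * (‖f t₀ x‖ + ‖f x x‖) := hb _ _ hx'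
        _ ≤ K * (M * Real.exp (L * (T - x)) + M * Real.exp (L * (T - x))) := by gcongr
        _ = 2 * K * M * Real.exp (L * (T - x)) := by ring)
    (right_mem_Icc.2 h₀.2.2)
  have hT0 : f t₀ T = 0 := hT t₀ ⟨h₀.1, h₀.2.1.trans h₀.2.2⟩
  simp only [hT0, zero_sub, norm_neg, sub_self, mul_zero, Real.exp_zero] at key
  have hstep : M ≤ 2 * K * M / L := by
    calc M ≤ Real.exp (-(L * (T - s₀))) * (2 * K * M / L * (Real.exp (L * (T - s₀)) - 1)) := by
          rw [hM]; gcongr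
      _ ≤ Real.exp (-(L * (T - s₀))) * (2 * K * M / L * Real.exp (L * (T - s₀))) := by
          gcongr; linarith
      _ = 2 * K * M / L := by
          rw [mul_left_comm, ← Real.exp_add]; simp
  have hM00 : M = 0 := by
    rw [le_div_iff₀ hLpos] at hstep
    nlinarith
  have := hle t s hts
  rw [hM00, zero_mul] at this
  exact norm_le_zero_iff.1 this

/-- A backward Grönwall estimate. The growth of `f` to the right of `s` is bounded below through a
minorant `g` that touches `f` at `s` and is differentiable there. -/
theorem le_exp_of_minorant_deriv {T K q : ℝ} (hK : 0 < K) {f : ℝ → ℝ}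
    (hf : ContinuousOn f (Icc 0 T))
    (h : ∀ s ∈ Ico 0 T, ∃ (g : ℝ → ℝ) (g' : ℝ), g s = f s ∧ (∀ r ∈ Icc s T, g r ≤ f r) ∧
      HasDerivWithinAt g g' (Icc s T) s ∧ -(K * f s + q) ≤ g') :
    ∀ s ∈ Icc 0 T, f s + q / K ≤ Real.exp (K * (T - s)) * (f T + q / K) := by
  intro s hs
  have key := image_le_of_liminf_slope_right_le_deriv_boundary (a := s) (b := T)
    (f := fun x => -(Real.exp (K * x) * (f x + q / K)))
    (B := fun _ => -(Real.exp (K * s) * (f s + q / K))) (B' := fun _ => 0)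
    (((Continuous.continuousOn (by fun_prop)).mul
      ((hf.mono (Icc_subset_Icc_left hs.1)).add continuousOn_const)).neg)
    le_rfl continuousOn_const (fun x _ => hasDerivWithinAt_const _ _ _)
    (fun x hx r hr => by
      obtain ⟨g, g', hgx, hgle, hgd, hg'⟩ := h x ⟨hs.1.trans hx.1, hx.2⟩
      have hE : HasDerivAt (fun z : ℝ => Real.exp (K * z)) (Real.exp (K * x) * K) x := by
        have h1 : HasDerivAt (fun z : ℝ => K * z) K x := by
          simpa using (hasDerivAt_id x).const_mul K
        exact h1.exp
      have hG : HasDerivWithinAt (fun z => -(Real.exp (K * z) * (g z + q / K)))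
          (-(Real.exp (K * x) * K * (g x + q / K) + Real.exp (K * x) * g')) (Ici x) x :=
        ((hE.hasDerivWithinAt.mul (hgd.add_const (q / K))).neg).mono_of_mem_nhdsWithin
          (Icc_mem_nhdsGE hx.2)
      have hneg : -(Real.exp (K * x) * K * (g x + q / K) + Real.exp (K * x) * g') < r := by
        refine lt_of_le_of_lt ?_ hr
        have h1 : 0 ≤ K * f x + q + g' := by linarith
        have h2 : Real.exp (K * x) * K * (g x + q / K) + Real.exp (K * x) * g' =
            Real.exp (K * x) * (K * f x + q + g') := by
          rw [hgx]; field_simp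
        rw [h2]
        have := mul_nonneg (Real.exp_pos (K * x)).le h1
        linarith
      refine ((hG.liminf_right_slope_le hneg).and_eventually
        (Ioc_mem_nhdsGT hx.2)).mono fun z hz => lt_of_le_of_lt ?_ hz.1
      rw [slope_def_field, slope_def_field]
      have hz1 : 0 < z - x := sub_pos.2 hz.2.1
      have hz2 := hgle z ⟨hz.2.1.le, hz.2.2⟩
      rw [hgx]
      gcongr)
    (right_mem_Icc.2 hs.2)
  have h1 : Real.exp (K * s) * (f s + q / K) ≤ Real.exp (K * T) * (f T + q / K) := by linarith
  have h2 : Real.exp (K * (T - s)) * (f T + q / K) =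
      Real.exp (-(K * s)) * (Real.exp (K * T) * (f T + q / K)) := by
    rw [← mul_assoc, ← Real.exp_add]; ring_nf
  rw [h2]
  calc f s + q / K = Real.exp (-(K * s)) * (Real.exp (K * s) * (f s + q / K)) := by
        rw [← mul_assoc, ← Real.exp_add]; simp
    _ ≤ _ := by gcongr

/-! ### Bounded Lipschitz families -/

/-- A family of maps that is bounded and Lipschitz on `S`, uniformly in the index. -/
def UnifBddLip {ι E F : Type*} [NormedAddCommGroup E] [NormedAddCommGroup F] (S : Set E)
    (f : ι → E → F) : Prop :=
  ∃ K : ℝ, 0 ≤ K ∧ ∀ i, ∀ x ∈ S, ‖f i x‖ ≤ K ∧ ∀ y ∈ S, ‖f i x - f i y‖ ≤ K * ‖x - y‖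

namespace UnifBddLip

variable {ι E F F' : Type*} [NormedAddCommGroup E] [NormedAddCommGroup F] [NormedAddCommGroup F']
  {S : Set E}

theorem const {f : ι → F} {K : ℝ} (h : ∀ i, ‖f i‖ ≤ K) : UnifBddLip S (fun i (_ : E) => f i) :=
  ⟨max K 0, le_max_right _ _, fun i x _ => ⟨(h i).trans (le_max_left _ _), fun y _ => by
    simpa using mul_nonneg (le_max_right K 0) (norm_nonneg (x - y))⟩⟩

theorem add {f g : ι → E → F} (hf : UnifBddLip S f) (hg : UnifBddLip S g) :
    UnifBddLip S (fun i x => f i x + g i x) := by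
  obtain ⟨K, hK, hf⟩ := hf
  obtain ⟨K', hK', hg⟩ := hg
  refine ⟨K + K', add_nonneg hK hK', fun i x hx => ⟨?_, fun y hy => ?_⟩⟩
  · exact norm_add_le_of_le (hf i x hx).1 (hg i x hx).1
  · rw [add_sub_add_comm, add_mul]
    exact norm_add_le_of_le ((hf i x hx).2 y hy) ((hg i x hx).2 y hy)

theorem neg {f : ι → E → F} (hf : UnifBddLip S f) : UnifBddLip S (fun i x => -f i x) := by
  obtain ⟨K, hK, hf⟩ := hf
  refine ⟨K, hK, fun i x hx => ⟨by rw [norm_neg]; exact (hf i x hx).1, fun y hy => ?_⟩⟩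
  rw [← neg_sub', norm_neg]
  exact (hf i x hx).2 y hy

theorem comp_lipschitz {f : ι → E → F} (hf : UnifBddLip S f) {J : F → F'} {k : NNReal}
    (hJ : LipschitzWith k J) : UnifBddLip S (fun i x => J (f i x)) := by
  obtain ⟨K, hK, hf⟩ := hf
  have hlip : ∀ u v, ‖J u - J v‖ ≤ k * ‖u - v‖ := fun u v => by
    simpa [dist_eq_norm] using hJ.dist_le_mul u v
  refine ⟨k * K + ‖J 0‖, by positivity, fun i x hx => ⟨?_, fun y hy => ?_⟩⟩
  · have h1 := hlip (f i x) 0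
    rw [sub_zero] at h1
    calc ‖J (f i x)‖ = ‖(J (f i x) - J 0) + J 0‖ := by rw [sub_add_cancel]
      _ ≤ k * K + ‖J 0‖ := norm_add_le_of_le (h1.trans (by gcongr; exact (hf i x hx).1)) le_rfl
  · calc ‖J (f i x) - J (f i y)‖ ≤ k * (K * ‖x - y‖) :=
          (hlip _ _).trans (by gcongr; exact (hf i x hx).2 y hy)
      _ = k * K * ‖x - y‖ := by ring
      _ ≤ (k * K + ‖J 0‖) * ‖x - y‖ := by
          gcongr
          linarith [norm_nonneg (J 0)]

theorem transpose {f : ι → E → Matrix (Fin n) (Fin m) ℝ} (hf : UnifBddLip S f) :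
    UnifBddLip S (fun i x => (f i x)ᵀ) := by
  obtain ⟨K, hK, hf⟩ := hf
  refine ⟨K, hK, fun i x hx => ⟨by rw [norm_transpose]; exact (hf i x hx).1, fun y hy => ?_⟩⟩
  rw [← transpose_sub, norm_transpose]
  exact (hf i x hx).2 y hy

theorem mul {f : ι → E → Matrix (Fin l) (Fin n) ℝ} {g : ι → E → Matrix (Fin n) (Fin m) ℝ}
    (hf : UnifBddLip S f) (hg : UnifBddLip S g) : UnifBddLip S (fun i x => f i x * g i x) := by
  obtain ⟨K, hK, hf⟩ := hf
  obtain ⟨K', hK', hg⟩ := hg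
  refine ⟨n * (K * K') + n * (K * K'), by positivity, fun i x hx => ⟨?_, fun y hy => ?_⟩⟩
  · calc ‖f i x * g i x‖ ≤ n * (K * K') := (norm_mul_le_card _ _).trans (by
          gcongr
          · exact (hf i x hx).1
          · exact (hg i x hx).1)
      _ ≤ n * (K * K') + n * (K * K') := by
          have : 0 ≤ n * (K * K') := by positivity
          linarith
  · have h : f i x * g i x - f i y * g i y = f i x * (g i x - g i y) + (f i x - f i y) * g i y := by
      rw [Matrix.mul_sub, Matrix.sub_mul]; abel
    rw [h]
    calc _ ≤ n * (K * (K' * ‖x - y‖)) + n * (K * ‖x - y‖ * K') := by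
          refine norm_add_le_of_le ((norm_mul_le_card _ _).trans ?_)
            ((norm_mul_le_card _ _).trans ?_)
          · gcongr
            · exact (hf i x hx).1
            · exact (hg i x hx).2 y hy
          · gcongr
            · exact (hf i x hx).2 y hy
            · exact (hg i y hy).1
      _ = _ := by ring

theorem fst (M : ℝ) : UnifBddLip (Metric.closedBall (0 : E × F) M) (fun (_ : ι) x => x.1) :=
  ⟨max M 1, by positivity, fun _ x hx => ⟨(norm_fst_le x).trans
    ((mem_closedBall_zero_iff.1 hx).trans (le_max_left _ _)), fun y _ =>
      (norm_fst_le (x - y)).trans (le_mul_of_one_le_left (norm_nonneg _) (le_max_right _ _))⟩⟩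

theorem snd (M : ℝ) : UnifBddLip (Metric.closedBall (0 : E × F) M) (fun (_ : ι) x => x.2) :=
  ⟨max M 1, by positivity, fun _ x hx => ⟨(norm_snd_le x).trans
    ((mem_closedBall_zero_iff.1 hx).trans (le_max_left _ _)), fun y _ =>
      (norm_snd_le (x - y)).trans (le_mul_of_one_le_left (norm_nonneg _) (le_max_right _ _))⟩⟩

end UnifBddLip

/-! ### A Lipschitz substitute for the matrix inverse -/

theorem posDef_of_sub_posSemidef {δ : ℝ} (hδ : 0 < δ) {S : Matrix (Fin m) (Fin m) ℝ}
    (hS : (S - δ • (1 : Matrix (Fin m) (Fin m) ℝ)).PosSemidef) : S.PosDef := by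
  have := PosDef.posSemidef_add hS ((PosDef.one (n := Fin m) (R := ℝ)).smul hδ)
  rwa [sub_add_cancel] at this

/-- With `v = S⁻¹ eⱼ`, the bound `S ≥ δ I` gives `δ |v|² ≤ vᵀ S v = vⱼ`. -/
theorem norm_inv_le {δ : ℝ} (hδ : 0 < δ) {S : Matrix (Fin m) (Fin m) ℝ}
    (hS : (S - δ • (1 : Matrix (Fin m) (Fin m) ℝ)).PosSemidef) : ‖S⁻¹‖ ≤ 1 / δ := by
  rw [Matrix.norm_le_iff (by positivity)]
  intro i j
  have hunit : IsUnit S.det := (isUnit_iff_isUnit_det S).1 (posDef_of_sub_posSemidef hδ hS).isUnit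
  set v : Fin m → ℝ := S⁻¹ *ᵥ Pi.single j 1 with hv
  have hvi : ∀ i, v i = S⁻¹ i j := fun i => by simp [hv]
  have hSv : S *ᵥ v = Pi.single j 1 := by
    rw [hv, mulVec_mulVec, mul_nonsing_inv S hunit, one_mulVec]
  have h1 := (posSemidef_iff_quadForm.1 hS).2 v
  have h2 : quadForm v (S - δ • (1 : Matrix (Fin m) (Fin m) ℝ)) = v j - δ * (v ⬝ᵥ v) := by
    rw [map_sub, map_smul, quadForm_apply, quadForm_apply, hSv, one_mulVec]
    simp
  rw [h2] at h1
  have hsq : ∀ i, v i ^ 2 ≤ v ⬝ᵥ v := fun i => by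
    rw [sq]
    exact Finset.single_le_sum (f := fun k => v k * v k) (fun k _ => mul_self_nonneg _)
      (Finset.mem_univ i)
  have hj : v j ≤ 1 / δ := by
    rw [le_div_iff₀ hδ]
    by_contra! h
    have hvj : 0 < v j := pos_of_mul_pos_left (zero_lt_one.trans h) hδ.le
    have h3 : δ * v j ^ 2 ≤ δ * (v ⬝ᵥ v) := by gcongr; exact hsq j
    nlinarith [mul_pos hvj (sub_pos.2 h)]
  rw [← hvi, Real.norm_eq_abs]
  refine abs_le_of_sq_le_sq ?_ (by positivity)
  calc v i ^ 2 ≤ v ⬝ᵥ v := hsq i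
    _ ≤ v j / δ := by rw [le_div_iff₀ hδ]; linarith
    _ ≤ (1 / δ) / δ := by gcongr
    _ = (1 / δ) ^ 2 := by ring

/-- Inversion is Lipschitz on the matrices `S ≥ δ I`, so it agrees there with a globally Lipschitz
map. -/
theorem exists_lipschitz_inv (m : ℕ) {δ : ℝ} (hδ : 0 < δ) :
    ∃ (k : NNReal) (J : Matrix (Fin m) (Fin m) ℝ → Matrix (Fin m) (Fin m) ℝ), LipschitzWith k J ∧
      ∀ S, (S - δ • (1 : Matrix (Fin m) (Fin m) ℝ)).PosSemidef → J S = S⁻¹ := by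
  have hlip : LipschitzOnWith (Real.toNNReal (m * (m * (1 / δ * (1 / δ)))))
      (fun S : Matrix (Fin m) (Fin m) ℝ => S⁻¹)
      {S | (S - δ • (1 : Matrix (Fin m) (Fin m) ℝ)).PosSemidef} := by
    refine LipschitzOnWith.of_dist_le_mul fun S hS S' hS' => ?_
    have hu := (isUnit_iff_isUnit_det S).1 (posDef_of_sub_posSemidef hδ hS).isUnit
    have hu' := (isUnit_iff_isUnit_det S').1 (posDef_of_sub_posSemidef hδ hS').isUnit
    have h : S⁻¹ - S'⁻¹ = S⁻¹ * ((S' - S) * S'⁻¹) := by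
      rw [Matrix.sub_mul, Matrix.mul_sub, mul_nonsing_inv S' hu', Matrix.mul_one,
        nonsing_inv_mul_cancel_left _ _ hu]
    rw [dist_eq_norm, dist_eq_norm, Real.coe_toNNReal _ (by positivity), h]
    calc ‖S⁻¹ * ((S' - S) * S'⁻¹)‖ ≤ m * (1 / δ * (m * (‖S' - S‖ * (1 / δ)))) := by
          refine (norm_mul_le_card _ _).trans ?_
          gcongr
          · exact norm_inv_le hδ hS
          · refine (norm_mul_le_card _ _).trans ?_
            gcongr
            exact norm_inv_le hδ hS'
      _ = m * (m * (1 / δ * (1 / δ))) * ‖S - S'‖ := by rw [norm_sub_rev]; ring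
  obtain ⟨J, hJ, heq⟩ := hlip.extend_finite_dimension
  exact ⟨_, J, hJ, fun S hS => (heq hS).symm⟩

/-! ### Coefficients on the whole plane -/

/-- Data that are continuous and bounded and satisfy the sign and monotonicity conditions at all
times `t, s ∈ ℝ`, without the constraint `t ≤ s`; `δ` is the lower bound for `R`. -/
structure Regular (c : SLQData n m) (δ : ℝ) : Prop where
  contA : Continuous c.A
  contB : Continuous c.B
  contC : Continuous c.C
  contD : Continuous c.D
  contQ : Continuous (Function.uncurry c.Q)
  contR : Continuous (Function.uncurry c.R)
  contG : Continuous c.G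
  bddA : ∃ K, ∀ s, ‖c.A s‖ ≤ K
  bddB : ∃ K, ∀ s, ‖c.B s‖ ≤ K
  bddC : ∃ K, ∀ s, ‖c.C s‖ ≤ K
  bddD : ∃ K, ∀ s, ‖c.D s‖ ≤ K
  bddQ : ∃ K, ∀ p, ‖Function.uncurry c.Q p‖ ≤ K
  bddR : ∃ K, ∀ p, ‖Function.uncurry c.R p‖ ≤ K
  pos : 0 < δ
  posQ : ∀ t s, (c.Q t s).PosSemidef
  posR : ∀ t s, (c.R t s - δ • (1 : Matrix (Fin m) (Fin m) ℝ)).PosSemidef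
  posG : ∀ t, (c.G t).PosSemidef
  monoQ : ∀ t r s, t ≤ r → (c.Q r s - c.Q t s).PosSemidef
  monoR : ∀ t r s, t ≤ r → (c.R r s - c.R t s).PosSemidef
  monoG : ∀ t r, t ≤ r → (c.G r - c.G t).PosSemidef

/-- The nearest point to `x` of the interval `[0, T]`. -/
def clamp (T x : ℝ) : ℝ := max 0 (min x T)

theorem continuous_clamp (T : ℝ) : Continuous (clamp T) := by unfold clamp; fun_prop

theorem clamp_mem {T : ℝ} (hT : 0 < T) (x : ℝ) : clamp T x ∈ Icc 0 T :=
  ⟨le_max_left _ _, max_le hT.le (min_le_right _ _)⟩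

theorem clamp_of_mem {T x : ℝ} (hx : x ∈ Icc 0 T) : clamp T x = x := by
  rw [clamp, min_eq_left hx.2, max_eq_right hx.1]

theorem clamp_mono (T : ℝ) : Monotone (clamp T) := fun _ _ h =>
  max_le_max le_rfl (min_le_min h le_rfl)

/-- The data extended to all times. Below the diagonal, where the original weights need be neither
positive nor monotone, `Q(t, s)` and `R(t, s)` are replaced by their values at `(s, s)`. -/
def extend (c : SLQData n m) (T : ℝ) : SLQData n m where
  A s := c.A (clamp T s)
  B s := c.B (clamp T s)
  C s := c.C (clamp T s)
  D s := c.D (clamp T s)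
  Q t s := c.Q (min (clamp T t) (clamp T s)) (clamp T s)
  R t s := c.R (min (clamp T t) (clamp T s)) (clamp T s)
  G t := c.G (clamp T t)

theorem continuous_comp_of_continuousOn {X Y Z : Type*} [TopologicalSpace X] [TopologicalSpace Y]
    [TopologicalSpace Z] {f : Y → Z} {S : Set Y} (hf : ContinuousOn f S) {g : X → Y}
    (hg : Continuous g) (h : ∀ x, g x ∈ S) : Continuous (fun x => f (g x)) :=
  continuousOn_univ.1 (hf.comp hg.continuousOn fun x _ => h x)

theorem bounded_comp_of_continuousOn {X Y F : Type*} [TopologicalSpace Y] [NormedAddCommGroup F]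
    {f : Y → F} {S : Set Y} (hS : IsCompact S) (hf : ContinuousOn f S) {g : X → Y}
    (h : ∀ x, g x ∈ S) : ∃ K, ∀ x, ‖f (g x)‖ ≤ K := by
  obtain ⟨K, hK⟩ := hS.exists_bound_of_continuousOn hf
  exact ⟨K, fun x => hK _ (h x)⟩

theorem exists_regular_extend {T : ℝ} (hT : 0 < T) {c : SLQData n m} (h1 : c.H1 T) (h2 : c.H2 T)
    (h3 : c.H3 T) : ∃ δ, Regular (extend c T) δ := by
  obtain ⟨δ, hδ, h2⟩ := h2
  obtain ⟨_, _, _, _, _, _, h3⟩ := h3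
  have hc := clamp_mem hT
  have hcc := continuous_clamp T
  have hmem : ∀ p : ℝ × ℝ, (min (clamp T p.1) (clamp T p.2), clamp T p.2) ∈ Icc 0 T ×ˢ Icc 0 T :=
    fun p => ⟨⟨le_min (hc _).1 (hc _).1, (min_le_left _ _).trans (hc _).2⟩, hc _⟩
  have hcont : Continuous fun p : ℝ × ℝ => (min (clamp T p.1) (clamp T p.2), clamp T p.2) := by
    fun_prop
  have hcomp : IsCompact (Icc (0 : ℝ) T ×ˢ Icc (0 : ℝ) T) := isCompact_Icc.prod isCompact_Icc
  have hp := fun t s => h2 (min (clamp T t) (clamp T s)) (clamp T s)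
    (hmem (t, s)).1.1 (min_le_right _ _) (hc s).2
  have hm := fun t r s (htr : t ≤ r) =>
    h3 (min (clamp T t) (clamp T s)) (min (clamp T r) (clamp T s)) (clamp T s) (hmem (t, s)).1.1
      (min_le_min (clamp_mono T htr) le_rfl) (min_le_right _ _) (hc s).2
  refine ⟨δ, ?_⟩
  constructor
  · exact continuous_comp_of_continuousOn (f := c.A) h1.contA hcc hc
  · exact continuous_comp_of_continuousOn (f := c.B) h1.contB hcc hc
  · exact continuous_comp_of_continuousOn (f := c.C) h1.contC hcc hc
  · exact continuous_comp_of_continuousOn (f := c.D) h1.contD hcc hc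
  · exact continuous_comp_of_continuousOn (f := Function.uncurry c.Q) h1.contQ hcont hmem
  · exact continuous_comp_of_continuousOn (f := Function.uncurry c.R) h1.contR hcont hmem
  · exact continuous_comp_of_continuousOn (f := c.G) h1.contG hcc hc
  · exact bounded_comp_of_continuousOn (f := c.A) isCompact_Icc h1.contA hc
  · exact bounded_comp_of_continuousOn (f := c.B) isCompact_Icc h1.contB hc
  · exact bounded_comp_of_continuousOn (f := c.C) isCompact_Icc h1.contC hc
  · exact bounded_comp_of_continuousOn (f := c.D) isCompact_Icc h1.contD hc
  · obtain ⟨K, hK⟩ := bounded_comp_of_continuousOn hcomp h1.contQ hmem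
    exact ⟨K, fun p => hK p⟩
  · obtain ⟨K, hK⟩ := bounded_comp_of_continuousOn hcomp h1.contR hmem
    exact ⟨K, fun p => hK p⟩
  · exact hδ
  · exact fun t s => (hp t s).1
  · exact fun t s => (hp t s).2.1
  · exact fun t => (h2 (clamp T t) (clamp T t) (hc t).1 le_rfl (hc t).2).2.2
  · exact fun t r s h => (hm t r s h).1
  · exact fun t r s h => (hm t r s h).2.2.1
  · exact fun t r h => (h3 (clamp T t) (clamp T r) (clamp T r) (hc t).1 (clamp_mono T h)
      le_rfl (hc r).2).2.2.2.2.1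

theorem theta_extend {T : ℝ} {c : SLQData n m} {P : ℝ → ℝ → Matrix (Fin n) (Fin n) ℝ} {s : ℝ}
    (hs : s ∈ Icc 0 T) : (extend c T).Theta P s = c.Theta P s := by
  simp [SLQData.Theta, extend, clamp_of_mem hs]

theorem isERESolution_extend_iff {T : ℝ} {c : SLQData n m}
    {P : ℝ → ℝ → Matrix (Fin n) (Fin n) ℝ} :
    (extend c T).IsERESolution T P ↔ c.IsERESolution T P := by
  have hTh : ∀ s ∈ Icc 0 T, (extend c T).Theta P s = c.Theta P s := fun _ hs =>
    theta_extend hs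
  have hA : ∀ s ∈ Icc 0 T, (extend c T).ATheta P s = c.ATheta P s := fun s hs => by
    rw [SLQData.ATheta, SLQData.ATheta, hTh s hs]; simp [extend, clamp_of_mem hs]
  have hC : ∀ s ∈ Icc 0 T, (extend c T).CTheta P s = c.CTheta P s := fun s hs => by
    rw [SLQData.CTheta, SLQData.CTheta, hTh s hs]; simp [extend, clamp_of_mem hs]
  have hQR : ∀ t s, (t, s) ∈ triangle T →
      (extend c T).Q t s = c.Q t s ∧ (extend c T).R t s = c.R t s := fun t s h => by
    simp only [extend]
    rw [clamp_of_mem ⟨h.1, h.2.1.trans h.2.2⟩, clamp_of_mem ⟨h.1.trans h.2.1, h.2.2⟩,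
      min_eq_left h.2.1]
    exact ⟨rfl, rfl⟩
  have hG : ∀ t ∈ Icc 0 T, (extend c T).G t = c.G t := fun t ht => by
    simp [extend, clamp_of_mem ht]
  constructor
  · intro h
    refine ⟨h.cont, h.posSemidef, fun t s hts => ?_, fun t ht => by rw [h.terminal t ht, hG t ht]⟩
    have hs : s ∈ Icc 0 T := ⟨hts.1.trans hts.2.1, hts.2.2⟩
    have := h.equation t s hts
    rwa [hTh s hs, hA s hs, hC s hs, (hQR t s hts).1, (hQR t s hts).2] at this
  · intro h
    refine ⟨h.cont, h.posSemidef, fun t s hts => ?_, fun t ht => by rw [h.terminal t ht, hG t ht]⟩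
    have hs : s ∈ Icc 0 T := ⟨hts.1.trans hts.2.1, hts.2.2⟩
    rw [hTh s hs, hA s hs, hC s hs, (hQR t s hts).1, (hQR t s hts).2]
    exact h.equation t s hts

/-! ### The right-hand side of the equation -/

section RightHandSide

variable (c : SLQData n m) (J : Matrix (Fin m) (Fin m) ℝ → Matrix (Fin m) (Fin m) ℝ)

/-- The feedback at time `s` when the diagonal value is `p`, with `J` in place of inversion. -/
def feedback (s : ℝ) (p : Matrix (Fin n) (Fin n) ℝ) : Matrix (Fin m) (Fin n) ℝ :=
  -(J (c.R s s + (c.D s)ᵀ * p * c.D s) * ((c.B s)ᵀ * p + (c.D s)ᵀ * p * c.C s))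

/-- The closed-loop drift coefficient `A + B θ`. -/
def driftCoeff (s : ℝ) (p : Matrix (Fin n) (Fin n) ℝ) : Matrix (Fin n) (Fin n) ℝ :=
  c.A s + c.B s * feedback c J s p

/-- The closed-loop diffusion coefficient `C + D θ`. -/
def diffusionCoeff (s : ℝ) (p : Matrix (Fin n) (Fin n) ℝ) : Matrix (Fin n) (Fin n) ℝ :=
  c.C s + c.D s * feedback c J s p

/-- The running cost `Q + θᵀ R θ`. -/
def source (t s : ℝ) (p : Matrix (Fin n) (Fin n) ℝ) : Matrix (Fin n) (Fin n) ℝ :=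
  c.Q t s + (feedback c J s p)ᵀ * c.R t s * feedback c J s p

/-- The field `Φ(t, s, y, p)` for which the equilibrium Riccati equation reads
`∂ₛ P(t, s) = -Φ(t, s, P(t, s), P(s, s))`. -/
def field (t s : ℝ) (y p : Matrix (Fin n) (Fin n) ℝ) : Matrix (Fin n) (Fin n) ℝ :=
  y * driftCoeff c J s p + (driftCoeff c J s p)ᵀ * y
    + (diffusionCoeff c J s p)ᵀ * y * diffusionCoeff c J s p + source c J t s p

variable {c J} {δ : ℝ} {k : NNReal}

theorem continuous_feedback (hc : Regular c δ) (hJ : LipschitzWith k J) :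
    Continuous (fun x : ℝ × Matrix (Fin n) (Fin n) ℝ => feedback c J x.1 x.2) := by
  have hA := hc.contA; have hB := hc.contB; have hC := hc.contC; have hD := hc.contD
  have hR : Continuous fun x : ℝ × Matrix (Fin n) (Fin n) ℝ => c.R x.1 x.1 :=
    hc.contR.comp (continuous_fst.prodMk continuous_fst)
  have hJ' := hJ.continuous
  unfold feedback
  fun_prop

theorem continuous_field (hc : Regular c δ) (hJ : LipschitzWith k J) :
    Continuous (fun x : (ℝ × ℝ) × Matrix (Fin n) (Fin n) ℝ × Matrix (Fin n) (Fin n) ℝ =>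
      field c J x.1.1 x.1.2 x.2.1 x.2.2) := by
  have hA := hc.contA; have hB := hc.contB; have hC := hc.contC; have hD := hc.contD
  have hf : Continuous fun x : (ℝ × ℝ) × Matrix (Fin n) (Fin n) ℝ × Matrix (Fin n) (Fin n) ℝ =>
      feedback c J x.1.2 x.2.2 := (continuous_feedback hc hJ).comp
        ((continuous_snd.comp continuous_fst).prodMk (continuous_snd.comp continuous_snd))
  have hQ : Continuous fun x : (ℝ × ℝ) × Matrix (Fin n) (Fin n) ℝ × Matrix (Fin n) (Fin n) ℝ =>
      c.Q x.1.1 x.1.2 := hc.contQ.comp continuous_fst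
  have hR : Continuous fun x : (ℝ × ℝ) × Matrix (Fin n) (Fin n) ℝ × Matrix (Fin n) (Fin n) ℝ =>
      c.R x.1.1 x.1.2 := hc.contR.comp continuous_fst
  unfold field driftCoeff diffusionCoeff source
  fun_prop

theorem unifBddLip_feedback (hc : Regular c δ) (hJ : LipschitzWith k J) (M : ℝ) :
    UnifBddLip (Metric.closedBall (0 : Matrix (Fin n) (Fin n) ℝ × Matrix (Fin n) (Fin n) ℝ) M)
      (fun (i : ℝ × ℝ) x => feedback c J i.2 x.2) := by
  set S := Metric.closedBall (0 : Matrix (Fin n) (Fin n) ℝ × Matrix (Fin n) (Fin n) ℝ) M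
  obtain ⟨_, hB⟩ := hc.bddB
  obtain ⟨_, hC⟩ := hc.bddC
  obtain ⟨_, hD⟩ := hc.bddD
  obtain ⟨_, hR⟩ := hc.bddR
  have hp : UnifBddLip S (fun (_ : ℝ × ℝ) x => x.2) := .snd M
  have hB' : UnifBddLip S (fun (i : ℝ × ℝ) _ => c.B i.2) := .const fun i => hB i.2
  have hC' : UnifBddLip S (fun (i : ℝ × ℝ) _ => c.C i.2) := .const fun i => hC i.2
  have hD' : UnifBddLip S (fun (i : ℝ × ℝ) _ => c.D i.2) := .const fun i => hD i.2
  have hR' : UnifBddLip S (fun (i : ℝ × ℝ) _ => c.R i.2 i.2) := .const fun i => hR (i.2, i.2)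
  have hpD := hD'.transpose.mul hp
  have hgain := (hR'.add (hpD.mul hD')).comp_lipschitz hJ
  have hcross := (hB'.transpose.mul hp).add (hpD.mul hC')
  exact (hgain.mul hcross).neg

theorem unifBddLip_driftCoeff (hc : Regular c δ) (hJ : LipschitzWith k J) (M : ℝ) :
    UnifBddLip (Metric.closedBall (0 : Matrix (Fin n) (Fin n) ℝ × Matrix (Fin n) (Fin n) ℝ) M)
      (fun (i : ℝ × ℝ) x => driftCoeff c J i.2 x.2) := by
  set S := Metric.closedBall (0 : Matrix (Fin n) (Fin n) ℝ × Matrix (Fin n) (Fin n) ℝ) M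
  obtain ⟨_, hA⟩ := hc.bddA
  obtain ⟨_, hB⟩ := hc.bddB
  have hA' : UnifBddLip S (fun (i : ℝ × ℝ) _ => c.A i.2) := .const fun i => hA i.2
  have hB' : UnifBddLip S (fun (i : ℝ × ℝ) _ => c.B i.2) := .const fun i => hB i.2
  exact hA'.add (hB'.mul (unifBddLip_feedback hc hJ M))

theorem unifBddLip_diffusionCoeff (hc : Regular c δ) (hJ : LipschitzWith k J) (M : ℝ) :
    UnifBddLip (Metric.closedBall (0 : Matrix (Fin n) (Fin n) ℝ × Matrix (Fin n) (Fin n) ℝ) M)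
      (fun (i : ℝ × ℝ) x => diffusionCoeff c J i.2 x.2) := by
  set S := Metric.closedBall (0 : Matrix (Fin n) (Fin n) ℝ × Matrix (Fin n) (Fin n) ℝ) M
  obtain ⟨_, hC⟩ := hc.bddC
  obtain ⟨_, hD⟩ := hc.bddD
  have hC' : UnifBddLip S (fun (i : ℝ × ℝ) _ => c.C i.2) := .const fun i => hC i.2
  have hD' : UnifBddLip S (fun (i : ℝ × ℝ) _ => c.D i.2) := .const fun i => hD i.2
  exact hC'.add (hD'.mul (unifBddLip_feedback hc hJ M))

theorem unifBddLip_source (hc : Regular c δ) (hJ : LipschitzWith k J) (M : ℝ) :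
    UnifBddLip (Metric.closedBall (0 : Matrix (Fin n) (Fin n) ℝ × Matrix (Fin n) (Fin n) ℝ) M)
      (fun (i : ℝ × ℝ) x => source c J i.1 i.2 x.2) := by
  set S := Metric.closedBall (0 : Matrix (Fin n) (Fin n) ℝ × Matrix (Fin n) (Fin n) ℝ) M
  obtain ⟨_, hQ⟩ := hc.bddQ
  obtain ⟨_, hR⟩ := hc.bddR
  have hQ' : UnifBddLip S (fun (i : ℝ × ℝ) _ => c.Q i.1 i.2) := .const hQ
  have hR' : UnifBddLip S (fun (i : ℝ × ℝ) _ => c.R i.1 i.2) := .const hR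
  have hf := unifBddLip_feedback hc hJ M
  exact hQ'.add ((hf.transpose.mul hR').mul hf)

theorem unifBddLip_field (hc : Regular c δ) (hJ : LipschitzWith k J) (M : ℝ) :
    UnifBddLip (Metric.closedBall (0 : Matrix (Fin n) (Fin n) ℝ × Matrix (Fin n) (Fin n) ℝ) M)
      (fun (i : ℝ × ℝ) x => field c J i.1 i.2 x.1 x.2) := by
  set S := Metric.closedBall (0 : Matrix (Fin n) (Fin n) ℝ × Matrix (Fin n) (Fin n) ℝ) M
  have hy : UnifBddLip S (fun (_ : ℝ × ℝ) x => x.1) := .fst M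
  have ha := unifBddLip_driftCoeff hc hJ M
  have hd := unifBddLip_diffusionCoeff hc hJ M
  have h1 := (hy.mul ha).add (ha.transpose.mul hy)
  have h2 := (hd.transpose.mul hy).mul hd
  exact (h1.add h2).add (unifBddLip_source hc hJ M)

theorem gain_sub_posSemidef (hc : Regular c δ) {p : Matrix (Fin n) (Fin n) ℝ}
    (hp : p.PosSemidef) (s : ℝ) :
    (c.R s s + (c.D s)ᵀ * p * c.D s - δ • (1 : Matrix (Fin m) (Fin m) ℝ)).PosSemidef := by
  rw [add_sub_right_comm]
  exact (hc.posR s s).add (posSemidef_congr hp _)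

theorem theta_eq_feedback (hc : Regular c δ)
    (hinv : ∀ S, (S - δ • (1 : Matrix (Fin m) (Fin m) ℝ)).PosSemidef → J S = S⁻¹)
    {P : ℝ → ℝ → Matrix (Fin n) (Fin n) ℝ} {s : ℝ} (hp : (P s s).PosSemidef) :
    c.Theta P s = feedback c J s (P s s) := by
  rw [SLQData.Theta, feedback, hinv _ (gain_sub_posSemidef hc hp s)]

theorem source_posSemidef (hc : Regular c δ) (t s : ℝ) (p : Matrix (Fin n) (Fin n) ℝ) :
    (source c J t s p).PosSemidef :=
  (hc.posQ t s).add (posSemidef_congr (posDef_of_sub_posSemidef hc.pos (hc.posR t s)).posSemidef _)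

/-- The feedback is the minimizer of a convex quadratic function, so on the diagonal the field is
bounded above by its value for the zero control. -/
theorem trace_field_diag_le (hc : Regular c δ)
    (hinv : ∀ S, (S - δ • (1 : Matrix (Fin m) (Fin m) ℝ)).PosSemidef → J S = S⁻¹)
    {p : Matrix (Fin n) (Fin n) ℝ} (hp : p.PosSemidef) (s : ℝ) :
    (field c J s s p p).trace ≤
      (p * c.A s + (c.A s)ᵀ * p + (c.C s)ᵀ * p * c.C s + c.Q s s).trace := by
  set S : Matrix (Fin m) (Fin m) ℝ := c.R s s + (c.D s)ᵀ * p * c.D s with hS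
  have hSδ := gain_sub_posSemidef hc hp s
  have hSpd := posDef_of_sub_posSemidef hc.pos hSδ
  have hunit : IsUnit S.det := (isUnit_iff_isUnit_det S).1 hSpd.isUnit
  set θ := feedback c J s p with hθ
  have hθeq : S * θ = -((c.B s)ᵀ * p + (c.D s)ᵀ * p * c.C s) := by
    rw [hθ, feedback, ← hS, hinv S hSδ, Matrix.mul_neg, mul_nonsing_inv_cancel_left _ _ hunit]
  have hpt : pᵀ = p := (posSemidef_iff_quadForm.1 hp).1
  have hSt : Sᵀ = S := (posSemidef_iff_quadForm.1 hSpd.posSemidef).1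
  have hθeq' : θᵀ * S = -(p * c.B s + (c.C s)ᵀ * p * c.D s) := by
    have := congrArg Matrix.transpose hθeq
    simpa [hSt, hpt, Matrix.mul_assoc] using this
  have hR : c.R s s = S - (c.D s)ᵀ * p * c.D s := by rw [hS]; abel
  have hid : field c J s s p p =
      (p * c.A s + (c.A s)ᵀ * p + (c.C s)ᵀ * p * c.C s + c.Q s s) - θᵀ * S * θ := by
    have h1 : θᵀ * ((c.B s)ᵀ * p + (c.D s)ᵀ * p * c.C s) = -(θᵀ * S * θ) := by
      rw [Matrix.mul_assoc θᵀ S θ, hθeq, Matrix.mul_neg, neg_neg]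
    have h2 : (p * c.B s + (c.C s)ᵀ * p * c.D s) * θ = -(θᵀ * S * θ) := by
      rw [hθeq', Matrix.neg_mul, neg_neg]
    rw [field, driftCoeff, diffusionCoeff, source, ← hθ, hR]
    simp only [Matrix.mul_add, Matrix.add_mul, transpose_add, transpose_mul, Matrix.mul_sub,
      Matrix.sub_mul, ← Matrix.mul_assoc] at h1 h2 ⊢
    have h3 : θᵀ * S * θ + θᵀ * (c.B s)ᵀ * p + θᵀ * (c.D s)ᵀ * p * c.C s = 0 := by
      rw [add_assoc, h1]; abel
    have h4 : θᵀ * S * θ + p * c.B s * θ + (c.C s)ᵀ * p * c.D s * θ = 0 := by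
      rw [add_assoc, h2]; abel
    rw [← sub_eq_zero]
    calc _ = (θᵀ * S * θ + θᵀ * (c.B s)ᵀ * p + θᵀ * (c.D s)ᵀ * p * c.C s)
          + (θᵀ * S * θ + p * c.B s * θ + (c.C s)ᵀ * p * c.D s * θ) := by abel
      _ = 0 := by rw [h3, h4, add_zero]
  rw [hid, trace_sub]
  have := (posSemidef_congr hSpd.posSemidef θ).trace_nonneg
  linarith

end RightHandSide

/-! ### Positivity without a symmetry assumption -/

theorem norm_lyapunov_le {K w : ℝ} (hK : 0 ≤ K) (hw : w ∈ Icc 0 1)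
    {Y a c : Matrix (Fin n) (Fin n) ℝ} (ha : ‖a‖ ≤ K) (hc : ‖c‖ ≤ K) :
    ‖Y * a + aᵀ * Y + w • (cᵀ * Y * c)‖ ≤ (n * K + n * K + n * (n * K * K)) * ‖Y‖ := by
  have h1 : ‖Y * a‖ ≤ n * K * ‖Y‖ := by
    calc _ ≤ n * (‖Y‖ * ‖a‖) := norm_mul_le_card _ _
      _ ≤ n * (‖Y‖ * K) := by gcongr
      _ = _ := by ring
  have h2 : ‖aᵀ * Y‖ ≤ n * K * ‖Y‖ := by
    calc _ ≤ n * (‖aᵀ‖ * ‖Y‖) := norm_mul_le_card _ _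
      _ ≤ n * (K * ‖Y‖) := by rw [norm_transpose]; gcongr
      _ = _ := by ring
  have h3 : ‖w • (cᵀ * Y * c)‖ ≤ n * (n * K * K) * ‖Y‖ := by
    rw [norm_smul, Real.norm_of_nonneg hw.1]
    refine (mul_le_of_le_one_left (norm_nonneg _) hw.2).trans ?_
    calc _ ≤ n * (‖cᵀ * Y‖ * ‖c‖) := norm_mul_le_card _ _
      _ ≤ n * (n * (‖cᵀ‖ * ‖Y‖) * ‖c‖) := by gcongr; exact norm_mul_le_card _ _
      _ ≤ n * (n * (K * ‖Y‖) * K) := by rw [norm_transpose]; gcongr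
      _ = _ := by ring
  rw [add_mul, add_mul]
  exact norm_add_le_of_le (norm_add_le_of_le h1 h2) h3

/-- Solutions of the backward Lyapunov equation with positive semidefinite source and terminal value
are positive semidefinite. They are symmetric because `Y - Yᵀ` solves the homogeneous equation. -/
theorem posSemidef_of_lyapunov_of_bounded {T K : ℝ} (hK : 0 ≤ K)
    {Y a c q : ℝ → Matrix (Fin n) (Fin n) ℝ} {w : ℝ → ℝ}
    (hw : ∀ s ∈ Icc 0 T, w s ∈ Icc 0 1)
    (ha : ∀ s ∈ Icc 0 T, ‖a s‖ ≤ K) (hc : ∀ s ∈ Icc 0 T, ‖c s‖ ≤ K)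
    (hq : ∀ s ∈ Icc 0 T, (q s).PosSemidef)
    (hY : ∀ s ∈ Icc 0 T, HasDerivWithinAt Y
      (-(Y s * a s + (a s)ᵀ * Y s + w s • ((c s)ᵀ * Y s * c s) + q s)) (Icc 0 T) s)
    (hT : (Y T).PosSemidef) : ∀ s ∈ Icc 0 T, (Y s).PosSemidef := by
  have hsymm : ∀ s ∈ Icc 0 T, (Y s)ᵀ = Y s := by
    set W : ℝ → Matrix (Fin n) (Fin n) ℝ := fun s => Y s - (Y s)ᵀ with hWdef
    have hW : ∀ s ∈ Icc 0 T, HasDerivWithinAt W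
        (-(W s * a s + (a s)ᵀ * W s + w s • ((c s)ᵀ * W s * c s))) (Icc 0 T) s := by
      intro s hs
      have hqs := (posSemidef_iff_quadForm.1 (hq s hs)).1
      have htr : HasDerivWithinAt (fun s => (Y s)ᵀ) _ (Icc 0 T) s :=
        (transposeLinearEquiv (Fin n) (Fin n) ℝ
          ℝ).toLinearMap.toContinuousLinearMap.hasFDerivAt.comp_hasDerivWithinAt s (hY s hs)
      refine ((hY s hs).sub htr).congr_deriv ?_
      change _ - (-(Y s * a s + (a s)ᵀ * Y s + w s • ((c s)ᵀ * Y s * c s) + q s))ᵀ = _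
      simp only [hWdef, transpose_neg, transpose_add, transpose_smul, transpose_mul,
        transpose_transpose, hqs, Matrix.sub_mul, Matrix.mul_sub, smul_sub, Matrix.mul_assoc]
      abel
    have hWc : ContinuousOn W (Icc 0 T) := fun s hs => (hW s hs).continuousWithinAt
    have key := eq_zero_of_norm_deriv_le (T := T) (E := Matrix (Fin n) (Fin n) ℝ)
      (K := n * K + n * K + n * (n * K * K)) (by positivity) (f := fun _ s => W s)
      (f' := fun _ s => -(W s * a s + (a s)ᵀ * W s + w s • ((c s)ᵀ * W s * c s)))
      (hWc.comp continuousOn_snd fun p hp => ⟨hp.1.trans hp.2.1, hp.2.2⟩)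
      (fun t s h => (hW s ⟨h.1.trans h.2.1, h.2.2⟩).mono (Icc_subset_Icc_left h.1))
      (fun t s h => by
        have hs : s ∈ Icc 0 T := ⟨h.1.trans h.2.1, h.2.2⟩
        rw [norm_neg]
        refine (norm_lyapunov_le hK (hw s hs) (ha s hs) (hc s hs)).trans ?_
        have := norm_nonneg (W s)
        gcongr
        linarith)
      (fun t _ => by simp [hWdef, (posSemidef_iff_quadForm.1 hT).1])
    intro s hs
    exact (sub_eq_zero.1 (key s s ⟨hs.1, le_rfl, hs.2⟩)).symm
  refine posSemidef_of_lyapunov (K := K + K + n * (K * K)) (fun s hs => (hw s hs).1) ?_ hq hsymm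
    hY hT
  intro s hs
  refine norm_add_le_of_le (norm_add_le_of_le (ha s hs) ?_) ?_
  · rw [norm_transpose]; exact ha s hs
  · rw [norm_smul, Real.norm_of_nonneg (hw s hs).1]
    refine (mul_le_of_le_one_left (norm_nonneg _) (hw s hs).2).trans ?_
    refine (norm_mul_le_card _ _).trans ?_
    rw [norm_transpose]
    gcongr
    · exact hc s hs
    · exact hc s hs

/-! ### A priori bounds for the truncated equation -/

/-- Solutions on the whole square `[0,T]²` of the equation in which every occurrence of `P` on the
right-hand side is scaled by a factor `w(s) ∈ [0, 1]`. -/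
structure IsTruncatedSolution (c : SLQData n m)
    (J : Matrix (Fin m) (Fin m) ℝ → Matrix (Fin m) (Fin m) ℝ) (T : ℝ) (w : ℝ → ℝ)
    (P : ℝ → ℝ → Matrix (Fin n) (Fin n) ℝ) : Prop where
  weight_mem : ∀ s ∈ Icc 0 T, w s ∈ Icc 0 1
  cont : ContinuousOn (Function.uncurry P) (Icc 0 T ×ˢ Icc 0 T)
  equation : ∀ t ∈ Icc 0 T, ∀ s ∈ Icc 0 T, HasDerivWithinAt (P t)
    (-field c J t s (w s • P t s) (w s • P s s)) (Icc 0 T) s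
  terminal : ∀ t ∈ Icc 0 T, P t T = c.G t

theorem field_smul (c : SLQData n m) (J : Matrix (Fin m) (Fin m) ℝ → Matrix (Fin m) (Fin m) ℝ)
    (t s w : ℝ) (y p : Matrix (Fin n) (Fin n) ℝ) :
    field c J t s (w • y) p = y * (w • driftCoeff c J s p) + (w • driftCoeff c J s p)ᵀ * y
      + w • ((diffusionCoeff c J s p)ᵀ * y * diffusionCoeff c J s p) + source c J t s p := by
  simp only [field, Matrix.smul_mul, Matrix.mul_smul, transpose_smul]

theorem norm_smul_le_of_mem {w : ℝ} (hw : w ∈ Icc 0 1) (M : Matrix (Fin n) (Fin m) ℝ) :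
    ‖w • M‖ ≤ ‖M‖ := by
  rw [norm_smul, Real.norm_of_nonneg hw.1]
  exact mul_le_of_le_one_left (norm_nonneg _) hw.2

/-- Bounds for the closed-loop coefficients and the source on bounded sets of diagonal values. -/
theorem exists_coeff_bound {c : SLQData n m} {δ : ℝ} {k : NNReal}
    {J : Matrix (Fin m) (Fin m) ℝ → Matrix (Fin m) (Fin m) ℝ} (hc : Regular c δ)
    (hJ : LipschitzWith k J) (M : ℝ) :
    ∃ K, 0 ≤ K ∧ ∀ (t s : ℝ) (p : Matrix (Fin n) (Fin n) ℝ), ‖p‖ ≤ M →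
      ‖driftCoeff c J s p‖ ≤ K ∧ ‖diffusionCoeff c J s p‖ ≤ K ∧ ‖source c J t s p‖ ≤ K := by
  obtain ⟨K₁, h₁, H₁⟩ := unifBddLip_driftCoeff hc hJ M
  obtain ⟨K₂, h₂, H₂⟩ := unifBddLip_diffusionCoeff hc hJ M
  obtain ⟨K₃, h₃, H₃⟩ := unifBddLip_source hc hJ M
  refine ⟨K₁ + K₂ + K₃, by positivity, fun t s p hp => ?_⟩
  have hmem : ((0, p) : Matrix (Fin n) (Fin n) ℝ × Matrix (Fin n) (Fin n) ℝ) ∈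
      Metric.closedBall 0 M := by
    rw [mem_closedBall_zero_iff, Prod.norm_def]
    simpa using hp
  have e₁ := (H₁ (t, s) _ hmem).1
  have e₂ := (H₂ (t, s) _ hmem).1
  have e₃ := (H₃ (t, s) _ hmem).1
  dsimp only at e₁ e₂ e₃
  exact ⟨by linarith, by linarith, by linarith⟩

namespace IsTruncatedSolution

variable {c : SLQData n m} {J : Matrix (Fin m) (Fin m) ℝ → Matrix (Fin m) (Fin m) ℝ} {T δ : ℝ}
  {k : NNReal} {w : ℝ → ℝ} {P : ℝ → ℝ → Matrix (Fin n) (Fin n) ℝ}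

theorem continuousOn_diag (hP : IsTruncatedSolution c J T w P) :
    ContinuousOn (fun s => P s s) (Icc 0 T) :=
  hP.cont.comp (continuousOn_id.prodMk continuousOn_id) fun _ hs => ⟨hs, hs⟩

theorem exists_diag_coeff_bound (hc : Regular c δ) (hJ : LipschitzWith k J)
    (hP : IsTruncatedSolution c J T w P) : ∃ K, 0 ≤ K ∧ ∀ s ∈ Icc 0 T,
      ‖w s • driftCoeff c J s (w s • P s s)‖ ≤ K ∧ ‖diffusionCoeff c J s (w s • P s s)‖ ≤ K := by
  obtain ⟨M, hM⟩ := isCompact_Icc.exists_bound_of_continuousOn hP.continuousOn_diag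
  obtain ⟨K, hK, H⟩ := exists_coeff_bound hc hJ M
  refine ⟨K, hK, fun s hs => ?_⟩
  have hw := hP.weight_mem s hs
  have h := H s s (w s • P s s) ((norm_smul_le_of_mem hw _).trans (hM s hs))
  exact ⟨(norm_smul_le_of_mem hw _).trans h.1, h.2.1⟩

theorem posSemidef (hc : Regular c δ) (hJ : LipschitzWith k J)
    (hP : IsTruncatedSolution c J T w P) {t s : ℝ} (ht : t ∈ Icc 0 T) (hs : s ∈ Icc 0 T) :
    (P t s).PosSemidef := by
  obtain ⟨K, hK, H⟩ := hP.exists_diag_coeff_bound hc hJ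
  refine posSemidef_of_lyapunov_of_bounded hK hP.weight_mem (fun s hs => (H s hs).1)
    (fun s hs => (H s hs).2)
    (fun r _ => source_posSemidef (J := J) hc t r (w r • P r r)) (fun s hs => ?_) ?_ s hs
  · rw [← field_smul]
    exact hP.equation t ht s hs
  · rw [hP.terminal t ht]
    exact hc.posG t

/-- Monotonicity in `t`: differences of two values of `t` solve a Lyapunov equation with
nonnegative data. -/
theorem sub_posSemidef (hc : Regular c δ) (hJ : LipschitzWith k J)
    (hP : IsTruncatedSolution c J T w P) {t r s : ℝ} (ht : t ∈ Icc 0 T) (hr : r ∈ Icc 0 T)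
    (htr : t ≤ r) (hs : s ∈ Icc 0 T) : (P r s - P t s).PosSemidef := by
  obtain ⟨K, hK, H⟩ := hP.exists_diag_coeff_bound hc hJ
  refine posSemidef_of_lyapunov_of_bounded (Y := fun s => P r s - P t s)
    (q := fun s => source c J r s (w s • P s s) - source c J t s (w s • P s s)) hK hP.weight_mem
    (fun s hs => (H s hs).1) (fun s hs => (H s hs).2) (fun s _ => ?_) (fun s hs => ?_) ?_ s hs
  · have h : source c J r s (w s • P s s) - source c J t s (w s • P s s) =
        (c.Q r s - c.Q t s) + (feedback c J s (w s • P s s))ᵀ * (c.R r s - c.R t s)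
          * feedback c J s (w s • P s s) := by
      rw [source, source, Matrix.mul_sub, Matrix.sub_mul]; abel
    rw [h]
    exact (hc.monoQ t r s htr).add (posSemidef_congr (hc.monoR t r s htr) _)
  · refine ((hP.equation r hr s hs).sub (hP.equation t ht s hs)).congr_deriv ?_
    rw [field_smul, field_smul]
    simp only [Matrix.mul_sub, Matrix.sub_mul, smul_sub]
    abel
  · rw [hP.terminal t ht, hP.terminal r hr]
    exact hc.monoG t r htr

theorem hasDerivWithinAt_trace (hP : IsTruncatedSolution c J T w P) {t s : ℝ} (ht : t ∈ Icc 0 T)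
    (hs : s ∈ Icc 0 T) : HasDerivWithinAt (fun r => (P t r).trace)
      (-(field c J t s (w s • P t s) (w s • P s s)).trace) (Icc s T) s := by
  rw [← trace_neg]
  exact ((traceLinearMap (Fin n) ℝ ℝ).toContinuousLinearMap.hasFDerivAt.comp_hasDerivWithinAt s
    (hP.equation t ht s hs)).mono (Icc_subset_Icc_left hs.1)

end IsTruncatedSolution

section Bounds

variable {c : SLQData n m} {J : Matrix (Fin m) (Fin m) ℝ → Matrix (Fin m) (Fin m) ℝ} {T δ : ℝ}
  {k : NNReal}

/-- The bound on the diagonal. By monotonicity in `t`, `r ↦ P(s, r)` is a minorant of the diagonal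
that touches it at `s`; by optimality of the feedback its derivative there is bounded below by that
of the uncontrolled equation, whatever the truncation. -/
theorem exists_trace_diag_bound (hT : 0 < T) (hc : Regular c δ) (hJ : LipschitzWith k J)
    (hinv : ∀ S, (S - δ • (1 : Matrix (Fin m) (Fin m) ℝ)).PosSemidef → J S = S⁻¹) :
    ∃ K, ∀ w P, IsTruncatedSolution c J T w P → ∀ s ∈ Icc 0 T, (P s s).trace ≤ K := by
  obtain ⟨KA, hA⟩ := hc.bddA
  obtain ⟨KC, hC⟩ := hc.bddC
  obtain ⟨q, hQ⟩ := hc.bddQ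
  have hKA : 0 ≤ KA := (norm_nonneg _).trans (hA 0)
  have hKC : 0 ≤ KC := (norm_nonneg _).trans (hC 0)
  set K := KA + KC with hK
  have hK0 : 0 ≤ K := add_nonneg hKA hKC
  set L := n * (n * K + n * K + n * (n * K * K)) + 1 with hL
  have hLpos : 0 < L := by positivity
  have hq : 0 ≤ q := (norm_nonneg _).trans (hQ 0)
  have hTm : T ∈ Icc 0 T := ⟨hT.le, le_rfl⟩
  refine ⟨Real.exp (L * T) * ((c.G T).trace + n * q / L), fun w P hP s hs => ?_⟩
  have key := le_exp_of_minorant_deriv (T := T) (q := n * q) hLpos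
    (f := fun s => (P s s).trace) (continuous_id.matrix_trace.comp_continuousOn hP.continuousOn_diag)
    (fun s hs' => by
      have hs : s ∈ Icc 0 T := Ico_subset_Icc_self hs'
      refine ⟨fun r => (P s r).trace, _, rfl, fun r hr => ?_, hP.hasDerivWithinAt_trace hs hs, ?_⟩
      · have hr' : r ∈ Icc 0 T := ⟨hs.1.trans hr.1, hr.2⟩
        have := (hP.sub_posSemidef hc hJ hs hr' hr.1 hr').trace_nonneg
        rw [trace_sub] at this
        linarith
      · have hw := hP.weight_mem s hs
        have hp := hP.posSemidef hc hJ hs hs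
        set p := P s s with hpdef
        have h1 := trace_field_diag_le hc hinv (hp.smul hw.1) s
        have h2 := abs_trace_le ((w s • p) * c.A s + (c.A s)ᵀ * (w s • p)
          + (c.C s)ᵀ * (w s • p) * c.C s + c.Q s s)
        have h3 := norm_lyapunov_le (Y := w s • p) (w := 1) hK0 ⟨zero_le_one, le_rfl⟩
          ((hA s).trans (by linarith)) ((hC s).trans (by linarith))
        rw [one_smul] at h3
        have h4 := norm_add_le_of_le h3 (hQ (s, s))
        have h5 : ‖w s • p‖ ≤ p.trace := (norm_smul_le_of_mem hw _).trans (norm_le_trace hp)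
        have h6 : (n : ℝ) * ‖(w s • p) * c.A s + (c.A s)ᵀ * (w s • p)
            + (c.C s)ᵀ * (w s • p) * c.C s + c.Q s s‖ ≤
            n * ((n * K + n * K + n * (n * K * K)) * p.trace + q) := by
          refine mul_le_mul_of_nonneg_left (h4.trans ?_) (Nat.cast_nonneg n)
          gcongr
        have h7 := (le_abs_self _).trans (h2.trans h6)
        have h8 := hp.trace_nonneg
        rw [hL]
        linarith)
    s hs
  have hG := (hc.posG T).trace_nonneg
  simp only [hP.terminal T hTm] at key
  have hqL : 0 ≤ n * q / L := by positivity
  calc (P s s).trace ≤ (P s s).trace + n * q / L := by linarith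
    _ ≤ _ := key
    _ ≤ _ := by
      gcongr
      linarith [hs.1]

/-- A bound for all truncated solutions on the whole square, independent of the truncation. The
bound on the diagonal bounds the feedback, after which the equation for `P(t, ·)` is linear with
bounded coefficients. -/
theorem exists_norm_bound (hT : 0 < T) (hc : Regular c δ) (hJ : LipschitzWith k J)
    (hinv : ∀ S, (S - δ • (1 : Matrix (Fin m) (Fin m) ℝ)).PosSemidef → J S = S⁻¹) :
    ∃ K, 0 ≤ K ∧ ∀ w P, IsTruncatedSolution c J T w P →
      ∀ t ∈ Icc 0 T, ∀ s ∈ Icc 0 T, ‖P t s‖ ≤ K := by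
  obtain ⟨M, hM⟩ := exists_trace_diag_bound (n := n) hT hc hJ hinv
  obtain ⟨K, hK0, H⟩ := exists_coeff_bound hc hJ M
  set L := n * (n * K + n * K + n * (n * K * K)) + 1 with hL
  have hLpos : 0 < L := by positivity
  have hTm : T ∈ Icc 0 T := ⟨hT.le, le_rfl⟩
  have hG := (hc.posG T).trace_nonneg
  refine ⟨Real.exp (L * T) * ((c.G T).trace + n * K / L), by positivity,
    fun w P hP t ht s hs => ?_⟩
  have hpsd := fun s hs => hP.posSemidef hc hJ (t := t) (s := s) ht hs
  have key := le_exp_of_minorant_deriv (T := T) (q := n * K) hLpos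
    (f := fun s => (P t s).trace)
    (continuous_id.matrix_trace.comp_continuousOn fun s hs => (hP.equation t ht s hs).continuousWithinAt)
    (fun s hs' => by
      have hs : s ∈ Icc 0 T := Ico_subset_Icc_self hs'
      refine ⟨fun r => (P t r).trace, _, rfl, fun r _ => le_rfl, hP.hasDerivWithinAt_trace ht hs, ?_⟩
      have hw := hP.weight_mem s hs
      have hpM : ‖w s • P s s‖ ≤ M := (norm_smul_le_of_mem hw _).trans
        ((norm_le_trace (hP.posSemidef hc hJ hs hs)).trans (hM w P hP s hs))
      obtain ⟨ha, hd, hsrc⟩ := H t s _ hpM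
      have h3 := norm_lyapunov_le (Y := P t s) hK0 hw ((norm_smul_le_of_mem hw _).trans ha) hd
      have h4 := norm_add_le_of_le h3 hsrc
      rw [← field_smul] at h4
      have h5 := norm_le_trace (hpsd s hs)
      have h6 : (n : ℝ) * ‖field c J t s (w s • P t s) (w s • P s s)‖ ≤
          n * ((n * K + n * K + n * (n * K * K)) * (P t s).trace + K) := by
        refine mul_le_mul_of_nonneg_left (h4.trans ?_) (Nat.cast_nonneg n)
        gcongr
      have h7 := (le_abs_self _).trans ((abs_trace_le _).trans h6)
      have h8 := (hpsd s hs).trace_nonneg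
      rw [hL]
      linarith)
    s hs
  have hGt : (c.G t).trace ≤ (c.G T).trace := by
    have := (hc.monoG t T ht.2).trace_nonneg
    rw [trace_sub] at this
    linarith
  have hG0 := (hc.posG t).trace_nonneg
  simp only [hP.terminal t ht] at key
  have hqL : 0 ≤ n * K / L := by positivity
  calc ‖P t s‖ ≤ (P t s).trace + n * K / L := by linarith [norm_le_trace (hpsd s hs)]
    _ ≤ _ := key
    _ ≤ _ := by
      gcongr
      linarith [hs.1]

end Bounds

/-! ### Radial truncation -/

section RadialTruncation

variable {X : Type*} [NormedAddCommGroup X]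

/-- The factor that scales `u` back into the closed ball of radius `M`. -/
noncomputable def radialFactor (M : ℝ) (u : X) : ℝ := M / max M ‖u‖

variable {M : ℝ}

theorem radialFactor_mem (hM : 0 < M) (u : X) : radialFactor M u ∈ Icc 0 1 := by
  have h : 0 < max M ‖u‖ := lt_max_of_lt_left hM
  exact ⟨by unfold radialFactor; positivity, (div_le_one h).2 (le_max_left _ _)⟩

theorem radialFactor_eq_one (hM : 0 < M) {u : X} (hu : ‖u‖ ≤ M) : radialFactor M u = 1 := by
  rw [radialFactor, max_eq_left hu, div_self hM.ne']

variable [NormedSpace ℝ X]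

theorem norm_radialFactor_smul_le (hM : 0 < M) (u : X) : ‖radialFactor M u • u‖ ≤ M := by
  have h : 0 < max M ‖u‖ := lt_max_of_lt_left hM
  rw [norm_smul, Real.norm_of_nonneg (radialFactor_mem hM u).1, radialFactor, div_mul_eq_mul_div,
    div_le_iff₀ h]
  gcongr
  exact le_max_right _ _

theorem norm_radialFactor_smul_sub_le (hM : 0 < M) (u v : X) :
    ‖radialFactor M u • u - radialFactor M v • v‖ ≤ 2 * ‖u - v‖ := by
  have ha : 0 < max M ‖u‖ := lt_max_of_lt_left hM
  have hb : 0 < max M ‖v‖ := lt_max_of_lt_left hM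
  have hsplit : radialFactor M u • u - radialFactor M v • v =
      radialFactor M u • (u - v) + (radialFactor M u - radialFactor M v) • v := by
    rw [smul_sub, sub_smul]; abel
  have h1 : ‖radialFactor M u • (u - v)‖ ≤ ‖u - v‖ := by
    rw [norm_smul, Real.norm_of_nonneg (radialFactor_mem hM u).1]
    exact mul_le_of_le_one_left (norm_nonneg _) (radialFactor_mem hM u).2
  have h2 : ‖(radialFactor M u - radialFactor M v) • v‖ ≤ ‖u - v‖ := by
    have heq : radialFactor M u - radialFactor M v =
        radialFactor M u * ((max M ‖v‖ - max M ‖u‖) / max M ‖v‖) := by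
      unfold radialFactor
      field_simp
    have hmax : |max M ‖v‖ - max M ‖u‖| ≤ ‖u - v‖ := by
      have := abs_max_sub_max_le_abs ‖v‖ ‖u‖ M
      rw [max_comm M, max_comm M]
      refine this.trans ?_
      rw [abs_sub_comm]
      exact abs_norm_sub_norm_le u v
    rw [norm_smul, heq, norm_mul, Real.norm_of_nonneg (radialFactor_mem hM u).1, norm_div,
      Real.norm_of_nonneg hb.le, mul_assoc]
    refine (mul_le_of_le_one_left (by positivity) (radialFactor_mem hM u).2).trans ?_
    rw [div_mul_eq_mul_div, div_le_iff₀ hb]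
    exact mul_le_mul hmax (le_max_right _ _) (norm_nonneg _) (norm_nonneg _)
  rw [hsplit, two_mul]
  exact norm_add_le_of_le h1 h2

end RadialTruncation

/-! ### Existence for the truncated equation -/

section BanachSpaceODE

variable {V : Type*} [NormedAddCommGroup V] {F : ℝ → ℝ → V → V → V} {T : ℝ}

/-- The family of equations `∂ₛ P(t, s) = F(t, s, P(t, s), P(s, s))` as an ordinary differential
equation in the Banach space `C([0,T]; V)`: the unknown at time `s` is the function `P(·, s)`, and
the diagonal value `P(s, s)` is obtained by evaluation at `s`. -/
noncomputable def vectorField (hT : 0 ≤ T)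
    (hF : Continuous fun x : (ℝ × ℝ) × V × V => F x.1.1 x.1.2 x.2.1 x.2.2) (s : ℝ)
    (u : C(Icc (0 : ℝ) T, V)) : C(Icc (0 : ℝ) T, V) where
  toFun t := F t s (u t) (u (projIcc 0 T hT s))
  continuous_toFun := by
    have h : Continuous fun t : Icc (0 : ℝ) T => (((t : ℝ), s), u t, u (projIcc 0 T hT s)) := by
      fun_prop
    exact hF.comp h

theorem continuous_vectorField (hT : 0 ≤ T)
    (hF : Continuous fun x : (ℝ × ℝ) × V × V => F x.1.1 x.1.2 x.2.1 x.2.2)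
    (u : C(Icc (0 : ℝ) T, V)) : Continuous fun s => vectorField hT hF s u := by
  refine ContinuousMap.continuous_of_continuous_uncurry _ ?_
  have hproj : Continuous (projIcc 0 T hT) := continuous_projIcc
  have h : Continuous fun p : ℝ × Icc (0 : ℝ) T =>
      (((p.2 : ℝ), p.1), u p.2, u (projIcc 0 T hT p.1)) := by
    fun_prop
  exact hF.comp h

theorem exists_vectorField_bound (hT : 0 ≤ T)
    (hF : Continuous fun x : (ℝ × ℝ) × V × V => F x.1.1 x.1.2 x.2.1 x.2.2) {M : ℝ}
    (hlip : UnifBddLip (Metric.closedBall (0 : V × V) M)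
      fun (i : ℝ × ℝ) x => F i.1 i.2 x.1 x.2) :
    ∃ K : ℝ, 0 ≤ K ∧ ∀ s, ∀ u v : C(Icc (0 : ℝ) T, V), ‖u‖ ≤ M → ‖v‖ ≤ M →
      ‖vectorField hT hF s u‖ ≤ K ∧
      ‖vectorField hT hF s u - vectorField hT hF s v‖ ≤ K * ‖u - v‖ := by
  obtain ⟨K, hK, H⟩ := hlip
  have hmem : ∀ (u : C(Icc (0 : ℝ) T, V)), ‖u‖ ≤ M → ∀ t r,
      (u t, u r) ∈ Metric.closedBall (0 : V × V) M := fun u hu t r => by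
    rw [mem_closedBall_zero_iff]
    exact max_le ((u.norm_coe_le_norm t).trans hu) ((u.norm_coe_le_norm r).trans hu)
  refine ⟨K, hK, fun s u v hu hv => ⟨?_, ?_⟩⟩
  · rw [ContinuousMap.norm_le _ hK]
    exact fun t => (H (t, s) _ (hmem u hu _ _)).1
  · rw [ContinuousMap.norm_le _ (by positivity)]
    intro t
    refine ((H (t, s) _ (hmem u hu t _)).2 _ (hmem v hv t _)).trans ?_
    gcongr
    exact max_le ((u - v).norm_coe_le_norm t) ((u - v).norm_coe_le_norm _)

/-- After truncation the vector field is bounded and globally Lipschitz, so the Picard–Lindelöf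
theorem gives a solution on the whole of `[0, T]`. -/
theorem exists_truncated_ode_solution [NormedSpace ℝ V] [CompleteSpace V] (hT : 0 < T)
    (hF : Continuous fun x : (ℝ × ℝ) × V × V => F x.1.1 x.1.2 x.2.1 x.2.2) {M : ℝ} (hM : 0 < M)
    (hlip : UnifBddLip (Metric.closedBall (0 : V × V) M)
      fun (i : ℝ × ℝ) x => F i.1 i.2 x.1 x.2) {g : ℝ → V} (hg : Continuous g) :
    ∃ (w : ℝ → ℝ) (P : ℝ → ℝ → V), (∀ s, w s ∈ Icc 0 1) ∧
      ContinuousOn (Function.uncurry P) (Icc 0 T ×ˢ Icc 0 T) ∧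
      (∀ t ∈ Icc 0 T, ∀ s ∈ Icc 0 T,
        HasDerivWithinAt (P t) (F t s (w s • P t s) (w s • P s s)) (Icc 0 T) s) ∧
      (∀ t ∈ Icc 0 T, P t T = g t) ∧
      ∀ s, (∀ t ∈ Icc 0 T, ‖P t s‖ ≤ M) → w s = 1 := by
  obtain ⟨K, hK, H⟩ := exists_vectorField_bound hT.le hF hlip
  set vf := fun (s : ℝ) (u : C(Icc (0 : ℝ) T, V)) =>
    vectorField hT.le hF s (radialFactor M u • u) with hvf
  set G : C(Icc (0 : ℝ) T, V) := ⟨fun t => g t, hg.comp continuous_subtype_val⟩ with hG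
  have hb := norm_radialFactor_smul_le (X := C(Icc (0 : ℝ) T, V)) hM
  -- The field is bounded by `K` everywhere, so the radius `K T` serves on the whole interval.
  have hPL : IsPicardLindelof vf (tmin := 0) (tmax := T) ⟨T, hT.le, le_rfl⟩ G
      (Real.toNNReal (K * T)) 0 (Real.toNNReal K) (Real.toNNReal (K * 2)) := by
    refine ⟨fun s _ => ?_, fun u _ => ?_, fun s _ u _ => ?_, ?_⟩
    · refine LipschitzOnWith.of_dist_le_mul fun u _ v _ => ?_
      rw [dist_eq_norm, dist_eq_norm, Real.coe_toNNReal _ (by positivity), mul_assoc]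
      refine (H s _ _ (hb u) (hb v)).2.trans ?_
      gcongr
      exact norm_radialFactor_smul_sub_le hM u v
    · exact (continuous_vectorField hT.le hF _).continuousOn
    · rw [Real.coe_toNNReal _ hK]
      exact (H s _ _ (hb u) (hb u)).1
    · rw [Real.coe_toNNReal _ hK, Real.coe_toNNReal _ (by positivity)]
      simp [hT.le]
  obtain ⟨α, hα0, hα⟩ := hPL.exists_eq_forall_mem_Icc_hasDerivWithinAt₀
  have hαc : ContinuousOn α (Icc 0 T) := fun s hs => (hα s hs).continuousWithinAt
  refine ⟨fun s => radialFactor M (α s), fun t s => α s (projIcc 0 T hT.le t),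
    fun s => radialFactor_mem hM _, ?_, fun t ht s hs => ?_, fun t ht => ?_, fun s h => ?_⟩
  · have hproj : Continuous (projIcc 0 T hT.le) := continuous_projIcc
    have h1 : ContinuousOn (fun p : ℝ × ℝ => α p.2) (Icc 0 T ×ˢ Icc 0 T) :=
      hαc.comp continuousOn_snd fun p hp => hp.2
    exact continuous_eval.comp_continuousOn
      (h1.prodMk (hproj.comp continuous_fst).continuousOn)
  · have h1 := (ContinuousMap.evalCLM ℝ (projIcc 0 T hT.le t)).hasFDerivAt.comp_hasDerivWithinAt s
      (hα s hs)
    refine h1.congr_deriv ?_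
    change F (projIcc 0 T hT.le t) s
      ((radialFactor M (α s) • α s) (projIcc 0 T hT.le t))
      ((radialFactor M (α s) • α s) (projIcc 0 T hT.le s)) = _
    dsimp only
    rw [projIcc_of_mem hT.le ht]
    rfl
  · have h1 : α T = G := hα0
    change α T (projIcc 0 T hT.le t) = g t
    rw [h1, projIcc_of_mem hT.le ht]
    rfl
  · refine radialFactor_eq_one hM ((ContinuousMap.norm_le _ hM.le).2 fun t => ?_)
    have := h t t.2
    dsimp only at this
    rwa [projIcc_of_mem hT.le t.2] at this

end BanachSpaceODE

variable {c : SLQData n m} {J : Matrix (Fin m) (Fin m) ℝ → Matrix (Fin m) (Fin m) ℝ} {T δ : ℝ}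
  {k : NNReal}

theorem exists_isTruncatedSolution (hT : 0 < T) (hc : Regular c δ) (hJ : LipschitzWith k J) {M : ℝ}
    (hM : 0 < M) : ∃ w P, IsTruncatedSolution c J T w P ∧
      ∀ s, (∀ t ∈ Icc 0 T, ‖P t s‖ ≤ M) → w s = 1 := by
  have : CompleteSpace (Matrix (Fin n) (Fin n) ℝ) := FiniteDimensional.complete ℝ _
  obtain ⟨w, P, hw, hcont, hder, hterm, hone⟩ := exists_truncated_ode_solution hT
    (F := fun t s y p => -field c J t s y p) (continuous_field hc hJ).neg hM
    (unifBddLip_field hc hJ M).neg hc.contG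
  exact ⟨w, P, ⟨fun s _ => hw s, hcont, hder, hterm⟩, hone⟩

/-! ### The equilibrium Riccati equation -/

theorem equation_rhs_eq_field (hc : Regular c δ)
    (hinv : ∀ S, (S - δ • (1 : Matrix (Fin m) (Fin m) ℝ)).PosSemidef → J S = S⁻¹)
    {P : ℝ → ℝ → Matrix (Fin n) (Fin n) ℝ} (t : ℝ) {s : ℝ} (hp : (P s s).PosSemidef) :
    P t s * c.ATheta P s + (c.ATheta P s)ᵀ * P t s + (c.CTheta P s)ᵀ * P t s * c.CTheta P s
      + c.Q t s + (c.Theta P s)ᵀ * c.R t s * c.Theta P s = field c J t s (P t s) (P s s) := by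
  rw [SLQData.ATheta, SLQData.CTheta, theta_eq_feedback hc hinv hp, field, source, driftCoeff,
    diffusionCoeff, ← add_assoc]

/-- When the truncation level exceeds the a priori bound the truncation is inactive. -/
theorem exists_isERESolution (hT : 0 < T) (hc : Regular c δ) (hJ : LipschitzWith k J)
    (hinv : ∀ S, (S - δ • (1 : Matrix (Fin m) (Fin m) ℝ)).PosSemidef → J S = S⁻¹) :
    ∃ P, c.IsERESolution T P := by
  obtain ⟨K, hK, hbound⟩ := exists_norm_bound (n := n) hT hc hJ hinv
  obtain ⟨w, P, hP, hw⟩ := exists_isTruncatedSolution hT hc hJ (M := K + 1) (by positivity)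
  have hw1 : ∀ s ∈ Icc 0 T, w s = 1 := fun s hs =>
    hw s fun t ht => (hbound w P hP t ht s hs).trans (by linarith)
  have hsub : ∀ t s, (t, s) ∈ triangle T → t ∈ Icc 0 T ∧ s ∈ Icc 0 T := fun t s h =>
    ⟨⟨h.1, h.2.1.trans h.2.2⟩, ⟨h.1.trans h.2.1, h.2.2⟩⟩
  refine ⟨P, hP.cont.mono fun p hp => hsub p.1 p.2 hp, fun t s h =>
    hP.posSemidef hc hJ (hsub t s h).1 (hsub t s h).2, fun t s h => ?_, hP.terminal⟩
  obtain ⟨ht, hs⟩ := hsub t s h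
  have h1 := hP.equation t ht s hs
  rw [hw1 s hs, one_smul, one_smul,
    ← equation_rhs_eq_field hc hinv t (hP.posSemidef hc hJ hs hs)] at h1
  exact h1.mono (Icc_subset_Icc_left ht.1)

theorem isERESolution_unique (hc : Regular c δ) (hJ : LipschitzWith k J)
    (hinv : ∀ S, (S - δ • (1 : Matrix (Fin m) (Fin m) ℝ)).PosSemidef → J S = S⁻¹)
    {P P' : ℝ → ℝ → Matrix (Fin n) (Fin n) ℝ} (hP : c.IsERESolution T P)
    (hP' : c.IsERESolution T P') (t s : ℝ) (hts : (t, s) ∈ triangle T) : P' t s = P t s := by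
  obtain ⟨M, hM⟩ := (isCompact_triangle T).exists_bound_of_continuousOn hP.cont
  obtain ⟨M', hM'⟩ := (isCompact_triangle T).exists_bound_of_continuousOn hP'.cont
  obtain ⟨K, hK, H⟩ := unifBddLip_field hc hJ (max M M')
  have hdiag : ∀ {t s}, (t, s) ∈ triangle T → (s, s) ∈ triangle T := fun h =>
    ⟨h.1.trans h.2.1, le_rfl, h.2.2⟩
  refine sub_eq_zero.1 (eq_zero_of_norm_deriv_le (T := T) (K := K) hK
    (f := fun t s => P' t s - P t s) (hP'.cont.sub hP.cont)
    (fun t s h => (hP'.equation t s h).sub (hP.equation t s h)) (fun t s h => ?_)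
    (fun t ht => by rw [hP.terminal t ht, hP'.terminal t ht, sub_self]) t s hts)
  rw [equation_rhs_eq_field hc hinv t (hP.posSemidef s s (hdiag h)),
    equation_rhs_eq_field hc hinv t (hP'.posSemidef s s (hdiag h)), ← neg_sub', norm_neg]
  have hx : (P t s, P s s) ∈ Metric.closedBall
      (0 : Matrix (Fin n) (Fin n) ℝ × Matrix (Fin n) (Fin n) ℝ) (max M M') := by
    rw [mem_closedBall_zero_iff]
    exact (max_le (hM _ h) (hM _ (hdiag h))).trans (le_max_left _ _)
  have hx' : (P' t s, P' s s) ∈ Metric.closedBall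
      (0 : Matrix (Fin n) (Fin n) ℝ × Matrix (Fin n) (Fin n) ℝ) (max M M') := by
    rw [mem_closedBall_zero_iff]
    exact (max_le (hM' _ h) (hM' _ (hdiag h))).trans (le_max_right _ _)
  refine ((H (t, s) _ hx').2 _ hx).trans ?_
  gcongr
  exact max_le_add_of_nonneg (norm_nonneg _) (norm_nonneg _)

theorem continuousOn_theta (hc : Regular c δ) (hJ : LipschitzWith k J)
    (hinv : ∀ S, (S - δ • (1 : Matrix (Fin m) (Fin m) ℝ)).PosSemidef → J S = S⁻¹)
    {P : ℝ → ℝ → Matrix (Fin n) (Fin n) ℝ} (hP : c.IsERESolution T P) :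
    ContinuousOn (c.Theta P) (Icc 0 T) := by
  have hmem : ∀ s ∈ Icc 0 T, (s, s) ∈ triangle T := fun s hs => ⟨hs.1, le_rfl, hs.2⟩
  have hdiag : ContinuousOn (fun s => P s s) (Icc 0 T) :=
    hP.cont.comp (continuousOn_id.prodMk continuousOn_id) hmem
  refine ((continuous_feedback hc hJ).comp_continuousOn (continuousOn_id.prodMk hdiag)).congr ?_
  exact fun s hs => theta_eq_feedback hc hinv (hP.posSemidef s s (hmem s hs))

end EquilibriumRiccati

theorem theorem4p2 (n m : ℕ) (T : ℝ) (hT : 0 < T) (c : SLQData n m)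
    (h1 : c.H1 T) (h2 : c.H2 T) (h3 : c.H3 T) (h4 : c.H4 T) :
    ∃ P : ℝ → ℝ → Matrix (Fin n) (Fin n) ℝ,
      c.IsERESolution T P ∧
      (∀ P' : ℝ → ℝ → Matrix (Fin n) (Fin n) ℝ, c.IsERESolution T P' →
        ∀ t s : ℝ, (t, s) ∈ triangle T → P' t s = P t s) ∧
      ContinuousOn (c.Theta P) (Set.Icc 0 T) := by
  obtain ⟨δ, hc⟩ := EquilibriumRiccati.exists_regular_extend hT h1 h2 h3
  obtain ⟨k, J, hJ, hinv⟩ := EquilibriumRiccati.exists_lipschitz_inv m hc.pos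
  obtain ⟨P, hP⟩ := EquilibriumRiccati.exists_isERESolution hT hc hJ hinv
  refine ⟨P, EquilibriumRiccati.isERESolution_extend_iff.1 hP, fun P' hP' t s hts => ?_, ?_⟩
  · exact EquilibriumRiccati.isERESolution_unique hc hJ hinv hP
      (EquilibriumRiccati.isERESolution_extend_iff.2 hP') t s hts
  · exact (EquilibriumRiccati.continuousOn_theta hc hJ hinv hP).congr fun s hs =>
      (EquilibriumRiccati.theta_extend hs).symm
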